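/- Theorem. Let $n\ge 0$ be an integer and let $z_1,\dots,z_n,\hbar,p$ be complex numbers. For $m\ge 0$ let $\mathrm{Tr}_m^{\,p}:\mathbb C[\mathfrak S_{n+m}]\to\mathbb C[\mathfrak S_n]$ be the linear map sending $\sigma\in\mathfrak S_{n+m}$ to $p^{\,c(\sigma)-c(\tau)}\,\tau$, where $\tau\in\mathfrak S_n$ is obtained by writing $\sigma$ as a product of cycles and removing all symbols $j>n$ from the record, $c(\sigma)$ is the number of $\sigma$-orbits in $\{1,\dots,n+m\}$ and $c(\tau)$ is the number of $\tau$-orbits in $\{1,\dots,n\}$ (fixed points counted). Let $A^{(m)}=\frac1{m!}\sum_{\sigma\in\mathfrak S_m}\operatorname{sign}(\sigma)\,\sigma$, let $\vartheta_m:\mathbb C[\mathfrak S_m]\to\mathbb C[\mathfrak S_{n+m}]$ be the embedding induced by $i\mapsto n+i$, and let $\sigma_{a,b}$ be the transposition of $a$ and $b$. Define the polynomial in $u$ with coefficients in $\mathbb C[\mathfrak S_n]$ $$T_m^{(n)}(u;p;\hbar)=\mathrm{Tr}_m^{\,p}\Bigl(\vartheta_m(A^{(m)})\,\bigl(u-z_n+\hbar\textstyle\sum_{i=1}^m\sigma_{n,n+i}\bigr)\cdots\bigl(u-z_1+\hbar\sum_{i=1}^m\sigma_{1,n+i}\bigr)\Bigr)=\sum_{i=0}^n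 T_{m,i}^{(n)}(p;\hbar)\,u^{n-i}.$$ Let $\mathcal B^S_{n,\hbar}(z_1,\dots,z_n)$ (the Bethe subalgebra of $\mathbb C[\mathfrak S_n]$ of XXX type) be the unital subalgebra of $\mathbb C[\mathfrak S_n]$ generated by all $T_{m,i}^{(n)}(p;\hbar)$ for $m=1,\dots,n-1$ and $i=1,\dots,n$, with the given $p$ and $\hbar$. Then $\mathcal B^S_{n,\hbar}(z_1,\dots,z_n)$ is commutative. -/

import Mathlib

open Polynomial

noncomputable section

namespace BetheXXX

/-- `C[S_α]`, the complex group algebra of the group of permutations of `α`.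
Products of permutations are compositions, the right factor being applied first. -/
abbrev GroupAlg (α : Type) : Type := MonoidAlgebra ℂ (Equiv.Perm α)

/-- The element of the group algebra given by a permutation. -/
def perm {α : Type} (σ : Equiv.Perm α) : GroupAlg α := MonoidAlgebra.single σ 1

/-! ### Removing the last `m` symbols from a permutation

The `n + m` symbols are the elements of `Fin n ⊕ Fin m`: the symbol `a ∈ {1, …, n}` is `Sum.inl`,
and the symbol `n + i`, `i ∈ {1, …, m}`, is `Sum.inr`. -/

theorem exists_return {n m : ℕ} (σ : Equiv.Perm (Fin n ⊕ Fin m)) (a : Fin n) :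
    ∃ k : ℕ, 1 ≤ k ∧ ((σ ^ k) (Sum.inl a)).isLeft = true :=
  ⟨orderOf σ, orderOf_pos σ, by simp [pow_orderOf_eq_one]⟩

/-- The least `k ≥ 1` such that `σ ^ k` takes the symbol `a ≤ n` to a symbol that is `≤ n`. -/
def returnTime {n m : ℕ} (σ : Equiv.Perm (Fin n ⊕ Fin m)) (a : Fin n) : ℕ :=
  Nat.find (exists_return σ a)

/-- The first symbol `≤ n` that is met after `a` in the cycle of `σ` through `a`. -/
def firstReturn {n m : ℕ} (σ : Equiv.Perm (Fin n ⊕ Fin m)) (a : Fin n) : Fin n :=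
  ((σ ^ returnTime σ a) (Sum.inl a)).getLeft (Nat.find_spec (exists_return σ a)).2

theorem inl_firstReturn {n m : ℕ} (σ : Equiv.Perm (Fin n ⊕ Fin m)) (a : Fin n) :
    (Sum.inl (firstReturn σ a) : Fin n ⊕ Fin m) = (σ ^ returnTime σ a) (Sum.inl a) :=
  Sum.inl_getLeft _ _

theorem eq_of_firstReturn_eq {n m : ℕ} (σ : Equiv.Perm (Fin n ⊕ Fin m)) {a b : Fin n}
    (hle : returnTime σ a ≤ returnTime σ b) (h : firstReturn σ a = firstReturn σ b) : a = b := by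
  have h1 : (σ ^ returnTime σ a) (Sum.inl a) = (σ ^ returnTime σ b) (Sum.inl b) := by
    rw [← inl_firstReturn, ← inl_firstReturn, h]
  obtain ⟨d, hd⟩ := Nat.exists_eq_add_of_le hle
  rw [hd, pow_add, Equiv.Perm.mul_apply] at h1
  have h2 : (Sum.inl a : Fin n ⊕ Fin m) = (σ ^ d) (Sum.inl b) := (σ ^ returnTime σ a).injective h1
  rcases Nat.eq_zero_or_pos d with h0 | h0
  · subst h0
    simpa using h2
  · have hpos : 1 ≤ returnTime σ a := (Nat.find_spec (exists_return σ a)).1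
    have hlt : d < returnTime σ b := by omega
    exact absurd ⟨h0, by rw [← h2]; rfl⟩ (Nat.find_min (exists_return σ b) hlt)

theorem firstReturn_injective {n m : ℕ} (σ : Equiv.Perm (Fin n ⊕ Fin m)) :
    Function.Injective (firstReturn σ) := by
  intro a b h
  rcases le_total (returnTime σ a) (returnTime σ b) with hle | hle
  · exact eq_of_firstReturn_eq σ hle h
  · exact (eq_of_firstReturn_eq σ hle h.symm).symm

/-- The permutation `τ ∈ S_n` obtained from `σ ∈ S_{n+m}` by removing all symbols `j > n` from
the record of `σ` as a product of cycles: `τ a` is the next symbol `≤ n` after `a` in its cycle. -/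
def removeLast {n m : ℕ} (σ : Equiv.Perm (Fin n ⊕ Fin m)) : Equiv.Perm (Fin n) :=
  Equiv.ofBijective (firstReturn σ) (Finite.injective_iff_bijective.mp (firstReturn_injective σ))

/-- The number `c(σ)` of orbits of a permutation, fixed points included. -/
def numOrbits {α : Type} (σ : Equiv.Perm α) : ℕ :=
  Nat.card (Quotient (Equiv.Perm.SameCycle.setoid σ))

theorem sameCycle_of_removeLast {n m : ℕ} (σ : Equiv.Perm (Fin n ⊕ Fin m)) {a b : Fin n}
    (h : σ.SameCycle (Sum.inl a) (Sum.inl b)) : (removeLast σ).SameCycle a b := by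
  obtain ⟨k, -, hk⟩ := h.exists_pow_eq'
  clear h
  induction k using Nat.strong_induction_on generalizing a with
  | _ k ih =>
    rcases Nat.eq_zero_or_pos k with h0 | h0
    · subst h0
      have : a = b := by simpa using hk
      subst this
      exact Equiv.Perm.SameCycle.refl _ _
    · have hpos : 1 ≤ returnTime σ a := (Nat.find_spec (exists_return σ a)).1
      have hle : returnTime σ a ≤ k := Nat.find_min' (exists_return σ a) ⟨h0, by rw [hk]; rfl⟩
      have h1 : (σ ^ (k - returnTime σ a)) (Sum.inl (firstReturn σ a)) = Sum.inl b := by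
        rw [inl_firstReturn, ← Equiv.Perm.mul_apply, ← pow_add, Nat.sub_add_cancel hle, hk]
      have h2 : (removeLast σ).SameCycle (removeLast σ a) b := ih _ (by omega) h1
      exact Equiv.Perm.sameCycle_apply_left.mp h2

/-- Removing symbols does not increase the number of orbits, so that the exponent
`c(σ) - c(τ)` below is an honest difference of natural numbers. -/
theorem numOrbits_removeLast_le {n m : ℕ} (σ : Equiv.Perm (Fin n ⊕ Fin m)) :
    numOrbits (removeLast σ) ≤ numOrbits σ := by
  have hsame : ∀ a : Fin n, σ.SameCycle (Sum.inl a) (Sum.inl (removeLast σ a)) := fun a =>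
    ⟨returnTime σ a, by rw [zpow_natCast]; exact (inl_firstReturn σ a).symm⟩
  have hpow : ∀ (k : ℕ) (a : Fin n),
      σ.SameCycle (Sum.inl a) (Sum.inl ((removeLast σ ^ k) a)) := by
    intro k
    induction k with
    | zero => intro a; exact Equiv.Perm.SameCycle.refl _ _
    | succ k ih =>
      intro a
      rw [pow_succ', Equiv.Perm.mul_apply]
      exact (ih a).trans (hsame _)
  let f : Quotient (Equiv.Perm.SameCycle.setoid (removeLast σ)) →
      Quotient (Equiv.Perm.SameCycle.setoid σ) :=
    Quotient.map' Sum.inl (by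
      intro a b hab
      obtain ⟨k, -, hk⟩ := Equiv.Perm.SameCycle.exists_pow_eq' hab
      have := hpow k a
      rw [hk] at this
      exact this)
  refine Nat.card_le_card_of_injective f ?_
  rintro ⟨a⟩ ⟨b⟩ hab
  exact Quotient.sound (sameCycle_of_removeLast σ (Quotient.exact hab))

/-! ### The partial trace and the polynomials `T_m` -/

/-- The linear map `Tr_m^p : C[S_{n+m}] → C[S_n]`, `σ ↦ p ^ (c(σ) - c(τ)) τ`, where `τ` is
obtained from `σ` by removing the symbols `> n`. -/
def partialTrace (n m : ℕ) (p : ℂ) : GroupAlg (Fin n ⊕ Fin m) →ₗ[ℂ] GroupAlg (Fin n) :=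
  (Finsupp.linearCombination ℂ fun σ : Equiv.Perm (Fin n ⊕ Fin m) =>
      p ^ (numOrbits σ - numOrbits (removeLast σ)) • perm (removeLast σ)) ∘ₗ
    (MonoidAlgebra.coeffLinearEquiv ℂ).toLinearMap

/-- The defining rule of the partial trace on permutations. -/
theorem partialTrace_perm {n m : ℕ} (p : ℂ) (σ : Equiv.Perm (Fin n ⊕ Fin m)) :
    partialTrace n m p (perm σ) =
      p ^ (numOrbits σ - numOrbits (removeLast σ)) • perm (removeLast σ) := by
  simp [partialTrace, perm]

/-- The antisymmetrizer `A^(m) = (1 / m!) ∑_σ sign(σ) σ` in `C[S_m]`. -/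
def antisymmetrizer (m : ℕ) : GroupAlg (Fin m) :=
  ((m.factorial : ℂ)⁻¹) • ∑ σ : Equiv.Perm (Fin m), ((Equiv.Perm.sign σ : ℤ) : ℂ) • perm σ

/-- The embedding `C[S_m] → C[S_{n+m}]` induced by `i ↦ n + i`. -/
def shift (n m : ℕ) : GroupAlg (Fin m) →ₐ[ℂ] GroupAlg (Fin n ⊕ Fin m) :=
  MonoidAlgebra.mapDomainAlgHom ℂ ℂ
    ((Equiv.Perm.sumCongrHom (Fin n) (Fin m)).comp (MonoidHom.inr _ _))

/-- The factor `u - z_a + ħ ∑_{i=1}^m σ_{a,n+i}`, a polynomial in `u` over `C[S_{n+m}]`. -/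
def factor {n : ℕ} (m : ℕ) (z : Fin n → ℂ) (ħ : ℂ) (a : Fin n) :
    (GroupAlg (Fin n ⊕ Fin m))[X] :=
  X - C (algebraMap ℂ _ (z a)) +
    C (ħ • ∑ i : Fin m, perm (Equiv.swap (Sum.inl a) (Sum.inr i)))

/-- The linear map `Tr_m^p` applied to the coefficients of a polynomial in `u`. -/
def partialTracePoly (n m : ℕ) (p : ℂ) (P : (GroupAlg (Fin n ⊕ Fin m))[X]) :
    (GroupAlg (Fin n))[X] :=
  P.sum fun k c => monomial k (partialTrace n m p c)

/-- The polynomial `T_m^(n)(u; p; ħ)`: the partial trace of the shifted antisymmetrizer times the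
ordered product of the factors with numbers `n, n - 1, …, 1`, in this order from left to right. -/
def T {n : ℕ} (m : ℕ) (z : Fin n → ℂ) (p ħ : ℂ) : (GroupAlg (Fin n))[X] :=
  partialTracePoly n m p
    (C (shift n m (antisymmetrizer m)) * (List.ofFn fun a : Fin n => factor m z ħ a).reverse.prod)

/-- The Bethe subalgebra of XXX type: the unital subalgebra of `C[S_n]` generated by all
`T_{m,i}^(n)(p; ħ)`, the coefficient of `u ^ (n - i)` in `T_m^(n)(u; p; ħ)`,
for `m = 1, …, n - 1` and `i = 1, …, n`. -/
def betheSubalgebra {n : ℕ} (z : Fin n → ℂ) (p ħ : ℂ) : Subalgebra ℂ (GroupAlg (Fin n)) :=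
  Algebra.adjoin ℂ {x | ∃ m i : ℕ, 1 ≤ m ∧ m < n ∧ 1 ≤ i ∧ i ≤ n ∧ x = (T m z p ħ).coeff (n - i)}

end BetheXXX

end

noncomputable section

namespace BetheXXX

/-! ### First returns and loops -/

/-- `Path σ x b`: the first symbol `≤ n` met strictly after `x` along `σ` is `b`. -/
inductive Path {n m : ℕ} (σ : Equiv.Perm (Fin n ⊕ Fin m)) : Fin n ⊕ Fin m → Fin n → Prop
  | last {x b} : σ x = Sum.inl b → Path σ x b
  | step {x i b} : σ x = Sum.inr i → Path σ (Sum.inr i) b → Path σ x b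

theorem Path.unique {n m : ℕ} {σ : Equiv.Perm (Fin n ⊕ Fin m)} {x : Fin n ⊕ Fin m} {b c : Fin n}
    (hb : Path σ x b) (hc : Path σ x c) : b = c := by
  induction hb with
  | last h =>
    cases hc with
    | last h' => exact Sum.inl.inj (h.symm.trans h')
    | step h' _ => exact absurd (h.symm.trans h') (by simp)
  | step h _ ih =>
    cases hc with
    | last h' => exact absurd (h.symm.trans h') (by simp)
    | step h' hp => exact ih ((Sum.inr.inj (h.symm.trans h')) ▸ hp)

theorem path_of_pow {n m : ℕ} (σ : Equiv.Perm (Fin n ⊕ Fin m)) (b : Fin n) (k : ℕ) :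
    ∀ x, (σ ^ (k + 1)) x = Sum.inl b →
      (∀ j, 1 ≤ j → j < k + 1 → ((σ ^ j) x).isLeft = false) → Path σ x b := by
  induction k with
  | zero => intro x hx _; exact Path.last (by simpa using hx)
  | succ k ih =>
    intro x hx hj
    have h1 := hj 1 le_rfl (by omega)
    rw [pow_one] at h1
    obtain ⟨i, hi⟩ := Sum.isRight_iff.mp (by simpa using h1 : (σ x).isRight = true)
    refine Path.step hi (ih _ ?_ ?_)
    · rw [← hi, ← Equiv.Perm.mul_apply, ← pow_succ, hx]
    · intro j hj1 hj2
      rw [← hi, ← Equiv.Perm.mul_apply, ← pow_succ]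
      exact hj _ (by omega) (by omega)

theorem path_removeLast {n m : ℕ} (σ : Equiv.Perm (Fin n ⊕ Fin m)) (a : Fin n) :
    Path σ (Sum.inl a) (removeLast σ a) := by
  have hpos : 1 ≤ returnTime σ a := (Nat.find_spec (exists_return σ a)).1
  obtain ⟨k, hk⟩ := Nat.exists_eq_add_of_le' hpos
  refine path_of_pow σ _ k _ ?_ ?_
  · rw [← hk]; exact (inl_firstReturn σ a).symm
  · intro j h1 h2
    rw [← hk] at h2
    have := Nat.find_min (exists_return σ a) h2
    simpa [h1] using this

theorem removeLast_eq_of_path {n m : ℕ} {σ : Equiv.Perm (Fin n ⊕ Fin m)} {τ : Equiv.Perm (Fin n)}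
    (h : ∀ a, Path σ (Sum.inl a) (τ a)) : removeLast σ = τ :=
  Equiv.ext fun a => (path_removeLast σ a).unique (h a)

/-- A loop of `σ`: an orbit all of whose symbols are `> n`. -/
def IsLoop {n m : ℕ} (σ : Equiv.Perm (Fin n ⊕ Fin m)) (s : Set (Fin m)) : Prop :=
  s.Nonempty ∧ ∀ i ∈ s, Set.range (fun k : ℕ => (σ ^ k) (Sum.inr i)) = Sum.inr '' s

theorem sameCycle_iff_exists_pow {α : Type} [Finite α] {σ : Equiv.Perm α} {x y : α} :
    σ.SameCycle x y ↔ ∃ k : ℕ, (σ ^ k) x = y := by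
  constructor
  · intro h
    obtain ⟨k, -, hk⟩ := h.exists_pow_eq'
    exact ⟨k, hk⟩
  · rintro ⟨k, hk⟩
    exact ⟨k, by simpa using hk⟩

theorem range_quotient_inl {n m : ℕ} (σ : Equiv.Perm (Fin n ⊕ Fin m)) :
    {q : Quotient (Equiv.Perm.SameCycle.setoid σ) | ∃ a, q = Quotient.mk _ (Sum.inl a)}.ncard =
      numOrbits (removeLast σ) := by
  have hsame : ∀ a : Fin n, σ.SameCycle (Sum.inl a) (Sum.inl (removeLast σ a)) := fun a =>
    ⟨returnTime σ a, by rw [zpow_natCast]; exact (inl_firstReturn σ a).symm⟩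
  have hpow : ∀ (k : ℕ) (a : Fin n),
      σ.SameCycle (Sum.inl a) (Sum.inl ((removeLast σ ^ k) a)) := by
    intro k
    induction k with
    | zero => intro a; exact Equiv.Perm.SameCycle.refl _ _
    | succ k ih =>
      intro a
      rw [pow_succ', Equiv.Perm.mul_apply]
      exact (ih a).trans (hsame _)
  let f : Quotient (Equiv.Perm.SameCycle.setoid (removeLast σ)) →
      Quotient (Equiv.Perm.SameCycle.setoid σ) :=
    Quotient.map' Sum.inl (by
      intro a b hab
      obtain ⟨k, hk⟩ := sameCycle_iff_exists_pow.mp hab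
      exact hk ▸ hpow k a)
  have hf : Function.Injective f := by
    rintro ⟨a⟩ ⟨b⟩ hab
    exact Quotient.sound (sameCycle_of_removeLast σ (Quotient.exact hab))
  have hr : {q : Quotient (Equiv.Perm.SameCycle.setoid σ) |
      ∃ a, q = Quotient.mk _ (Sum.inl a)} = f '' Set.univ := by
    ext q
    constructor
    · rintro ⟨a, rfl⟩
      exact ⟨Quotient.mk _ a, trivial, rfl⟩
    · rintro ⟨⟨a⟩, -, rfl⟩
      exact ⟨a, rfl⟩
  rw [hr, Set.ncard_image_of_injective _ hf, Set.ncard_univ, numOrbits]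

/-- The orbits without symbols `≤ n` are the loops. -/
theorem ncard_compl_quotient_inl {n m : ℕ} (σ : Equiv.Perm (Fin n ⊕ Fin m)) :
    {q : Quotient (Equiv.Perm.SameCycle.setoid σ) | ∃ a, q = Quotient.mk _ (Sum.inl a)}ᶜ.ncard =
      {s | IsLoop σ s}.ncard := by
  let S : Quotient (Equiv.Perm.SameCycle.setoid σ) → Set (Fin m) :=
    fun q => {i | q = Quotient.mk _ (Sum.inr i)}
  have hmk : ∀ x y, (Quotient.mk (Equiv.Perm.SameCycle.setoid σ) x = Quotient.mk _ y) ↔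
      σ.SameCycle x y := fun x y => Quotient.eq
  have hinj : Set.InjOn S
      {q : Quotient (Equiv.Perm.SameCycle.setoid σ) | ∃ a, q = Quotient.mk _ (Sum.inl a)}ᶜ := by
    rintro ⟨x⟩ hq q' - h
    rcases x with a | i
    · exact absurd ⟨a, rfl⟩ hq
    · have : i ∈ S q' := h ▸ (rfl : i ∈ S (Quotient.mk _ (Sum.inr i)))
      exact this.symm
  rw [← hinj.ncard_image]
  congr 1
  ext s
  constructor
  · rintro ⟨q, hq, rfl⟩
    refine ⟨?_, fun i hi => ?_⟩
    · rcases q with ⟨a | i⟩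
      · exact absurd ⟨a, rfl⟩ hq
      · exact ⟨i, rfl⟩
    · change q = _ at hi
      subst hi
      ext y
      rw [Set.mem_range, ← sameCycle_iff_exists_pow]
      constructor
      · intro h
        rcases y with a | j
        · exact absurd ⟨a, (hmk _ _).mpr h⟩ hq
        · exact ⟨j, (hmk _ _).mpr h, rfl⟩
      · rintro ⟨j, hj, rfl⟩
        exact (hmk _ _).mp hj
  · rintro ⟨⟨i, hi⟩, hs⟩
    have hs' : ∀ y, σ.SameCycle (Sum.inr i) y ↔ y ∈ Sum.inr '' s := by
      intro y
      rw [← hs i hi, Set.mem_range, sameCycle_iff_exists_pow]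
    refine ⟨Quotient.mk _ (Sum.inr i), ?_, ?_⟩
    · rintro ⟨a, ha⟩
      have := (hs' _).mp ((hmk _ _).mp ha)
      simp at this
    · ext j
      change Quotient.mk _ _ = Quotient.mk _ _ ↔ _
      rw [hmk, hs']
      simp

theorem numOrbits_sub_numOrbits_removeLast {n m : ℕ} (σ : Equiv.Perm (Fin n ⊕ Fin m)) :
    numOrbits σ - numOrbits (removeLast σ) = {s | IsLoop σ s}.ncard := by
  rw [← ncard_compl_quotient_inl, ← range_quotient_inl, numOrbits, Set.ncard_compl]

theorem partialTrace_perm_eq {n m : ℕ} (p : ℂ) (σ : Equiv.Perm (Fin n ⊕ Fin m)) :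
    partialTrace n m p (perm σ) = p ^ {s | IsLoop σ s}.ncard • perm (removeLast σ) := by
  rw [partialTrace_perm, numOrbits_sub_numOrbits_removeLast]

/-! ### Relabelling the symbols `> n` -/

/-- The embedding of `Fin n ⊕ Fin m` into `Fin n ⊕ Fin l` that relabels the symbols `> n`. -/
def relabel (n : ℕ) {m l : ℕ} (f : Fin m ↪ Fin l) : Fin n ⊕ Fin m ↪ Fin n ⊕ Fin l :=
  Function.Embedding.sumMap (Function.Embedding.refl _) f

/-- The corresponding embedding of `S_{n+m}` into `S_{n+l}`. -/
def relabelPerm (n : ℕ) {m l : ℕ} (f : Fin m ↪ Fin l) :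
    Equiv.Perm (Fin n ⊕ Fin m) →* Equiv.Perm (Fin n ⊕ Fin l) :=
  Equiv.Perm.viaEmbeddingHom (relabel n f)

section relabel

variable {n m k l : ℕ}

theorem relabelPerm_inl (f : Fin m ↪ Fin l) (σ : Equiv.Perm (Fin n ⊕ Fin m)) (a : Fin n) :
    relabelPerm n f σ (Sum.inl a) = (σ (Sum.inl a)).map id f :=
  Equiv.Perm.viaEmbedding_apply σ (relabel n f) (Sum.inl a)

theorem relabelPerm_inr (f : Fin m ↪ Fin l) (σ : Equiv.Perm (Fin n ⊕ Fin m)) (i : Fin m) :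
    relabelPerm n f σ (Sum.inr (f i)) = (σ (Sum.inr i)).map id f :=
  Equiv.Perm.viaEmbedding_apply σ (relabel n f) (Sum.inr i)

theorem relabelPerm_of_notMem (f : Fin m ↪ Fin l) (σ : Equiv.Perm (Fin n ⊕ Fin m)) {i : Fin l}
    (hi : i ∉ Set.range f) : relabelPerm n f σ (Sum.inr i) = Sum.inr i :=
  Equiv.Perm.viaEmbedding_apply_of_notMem σ (relabel n f) _ (by
    rintro ⟨a | j, h⟩
    · exact absurd h (by simp [relabel])
    · exact hi ⟨j, Sum.inr.inj h⟩)

theorem path_relabel_mul_inr {f : Fin m ↪ Fin l} {g : Fin k ↪ Fin l}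
    (hfg : ∀ i j, f i ≠ g j) (σ : Equiv.Perm (Fin n ⊕ Fin m)) (ρ : Equiv.Perm (Fin n ⊕ Fin k))
    {x : Fin n ⊕ Fin m} {c : Fin n} (h : Path σ x c) :
    ∀ i, x = Sum.inr i → Path (relabelPerm n f σ * relabelPerm n g ρ) (Sum.inr (f i)) c := by
  have hfix : ∀ i, relabelPerm n g ρ (Sum.inr (f i)) = Sum.inr (f i) := fun i =>
    relabelPerm_of_notMem g ρ (by rintro ⟨j, hj⟩; exact hfg i j hj.symm)
  induction h with
  | last h =>
    rintro i rfl
    refine Path.last ?_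
    rw [Equiv.Perm.mul_apply, hfix, relabelPerm_inr, h]; rfl
  | @step x j b h _ ih =>
    rintro i rfl
    refine Path.step (i := f j) ?_ (ih j rfl)
    rw [Equiv.Perm.mul_apply, hfix, relabelPerm_inr, h]; rfl

theorem path_relabel_mul {f : Fin m ↪ Fin l} {g : Fin k ↪ Fin l}
    (hfg : ∀ i j, f i ≠ g j) (σ : Equiv.Perm (Fin n ⊕ Fin m)) (ρ : Equiv.Perm (Fin n ⊕ Fin k))
    {x : Fin n ⊕ Fin k} {b c : Fin n} (h : Path ρ x b) (hc : Path σ (Sum.inl b) c) :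
    Path (relabelPerm n f σ * relabelPerm n g ρ) (relabel n g x) c := by
  have hx : ∀ x, relabelPerm n g ρ (relabel n g x) = relabel n g (ρ x) :=
    Equiv.Perm.viaEmbedding_apply ρ (relabel n g)
  induction h with
  | @last x b h =>
    have hx' : (relabelPerm n f σ * relabelPerm n g ρ) (relabel n g x) =
        (σ (Sum.inl b)).map id f := by
      rw [Equiv.Perm.mul_apply, hx, h, ← relabelPerm_inl]; rfl
    cases hc with
    | last h' => exact Path.last (by rw [hx', h']; rfl)
    | @step _ i _ h' hp =>
      exact Path.step (i := f i) (by rw [hx', h']; rfl) (path_relabel_mul_inr hfg σ ρ hp i rfl)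
  | @step x j b h _ ih =>
    refine Path.step (i := g j) ?_ (ih hc)
    rw [Equiv.Perm.mul_apply, hx, h]
    exact relabelPerm_of_notMem f σ (by rintro ⟨i, hi⟩; exact hfg i j hi)

theorem removeLast_relabel_mul {f : Fin m ↪ Fin l} {g : Fin k ↪ Fin l}
    (hfg : ∀ i j, f i ≠ g j) (σ : Equiv.Perm (Fin n ⊕ Fin m)) (ρ : Equiv.Perm (Fin n ⊕ Fin k)) :
    removeLast (relabelPerm n f σ * relabelPerm n g ρ) = removeLast σ * removeLast ρ :=
  removeLast_eq_of_path fun a =>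
    path_relabel_mul hfg σ ρ (path_removeLast ρ a) (path_removeLast σ (removeLast ρ a))

/-- Loops are carried along injections that intertwine the permutations on them. -/
theorem isLoop_image_iff {n' : ℕ} {σ : Equiv.Perm (Fin n ⊕ Fin m)}
    {ψ : Equiv.Perm (Fin n' ⊕ Fin l)} (f : Fin m ↪ Fin l) (t : Set (Fin m))
    (h : ∀ i ∈ t, ∃ j ∈ t, σ (Sum.inr i) = Sum.inr j ∧ ψ (Sum.inr (f i)) = Sum.inr (f j)) :
    IsLoop ψ (f '' t) ↔ IsLoop σ t := by
  have hp : ∀ i ∈ t, ∀ e : ℕ, ∃ j ∈ t, (σ ^ e) (Sum.inr i) = Sum.inr j ∧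
      (ψ ^ e) (Sum.inr (f i)) = Sum.inr (f j) := by
    intro i hi e
    induction e with
    | zero => exact ⟨i, hi, rfl, rfl⟩
    | succ e ih =>
      obtain ⟨j, hj, h1, h2⟩ := ih
      obtain ⟨j', hj', h3, h4⟩ := h j hj
      exact ⟨j', hj', by rw [pow_succ', Equiv.Perm.mul_apply, h1, h3],
        by rw [pow_succ', Equiv.Perm.mul_apply, h2, h4]⟩
  have hr : ∀ i ∈ t, (Set.range (fun k : ℕ => (ψ ^ k) (Sum.inr (f i))) = Sum.inr '' (f '' t) ↔
      Set.range (fun k : ℕ => (σ ^ k) (Sum.inr i)) = Sum.inr '' t) := by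
    intro i hi
    choose j hjt h1 h2 using hp i hi
    have e1 : (fun k : ℕ => (ψ ^ k) (Sum.inr (f i))) = fun k => Sum.inr (f (j k)) := funext h2
    have e2 : (fun k : ℕ => (σ ^ k) (Sum.inr i)) = fun k => Sum.inr (j k) := funext h1
    have e3 : Set.range (fun k => (Sum.inr (f (j k)) : Fin n' ⊕ Fin l)) =
        Sum.inr '' (f '' Set.range j) := by
      rw [← Set.range_comp, ← Set.range_comp]; rfl
    have e4 : Set.range (fun k => (Sum.inr (j k) : Fin n ⊕ Fin m)) = Sum.inr '' Set.range j := by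
      rw [← Set.range_comp]; rfl
    rw [e1, e2, e3, e4, (Set.image_injective.mpr Sum.inr_injective).eq_iff,
      (Set.image_injective.mpr f.injective).eq_iff,
      (Set.image_injective.mpr Sum.inr_injective).eq_iff]
  unfold IsLoop
  rw [Set.image_nonempty, Set.forall_mem_image]
  exact and_congr_right fun _ => forall₂_congr hr

theorem IsLoop.exists_apply {σ : Equiv.Perm (Fin n ⊕ Fin m)} {s : Set (Fin m)} (h : IsLoop σ s)
    {i : Fin m} (hi : i ∈ s) : ∃ j ∈ s, σ (Sum.inr i) = Sum.inr j := by
  have : σ (Sum.inr i) ∈ Sum.inr '' s := h.2 i hi ▸ ⟨1, by simp⟩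
  obtain ⟨j, hj, h'⟩ := this
  exact ⟨j, hj, h'.symm⟩

theorem IsLoop.subset {σ : Equiv.Perm (Fin n ⊕ Fin m)} {s t : Set (Fin m)} (h : IsLoop σ s)
    {i : Fin m} (hs : i ∈ s) (ht : i ∈ t)
    (hinv : ∀ i ∈ s, i ∈ t → ∀ j, σ (Sum.inr i) = Sum.inr j → j ∈ t) : s ⊆ t := by
  have hp : ∀ e : ℕ, ∃ j ∈ s, j ∈ t ∧ (σ ^ e) (Sum.inr i) = Sum.inr j := by
    intro e
    induction e with
    | zero => exact ⟨i, hs, ht, rfl⟩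
    | succ e ih =>
      obtain ⟨j, hjs, hjt, hj⟩ := ih
      obtain ⟨j', hj', h'⟩ := h.exists_apply hjs
      exact ⟨j', hj', hinv j hjs hjt j' h', by rw [pow_succ', Equiv.Perm.mul_apply, hj, h']⟩
  intro j hj
  have : (Sum.inr j : Fin n ⊕ Fin m) ∈ Set.range (fun k : ℕ => (σ ^ k) (Sum.inr i)) :=
    h.2 i hs ▸ ⟨j, hj, rfl⟩
  obtain ⟨e, he⟩ := this
  obtain ⟨j', -, hj', h'⟩ := hp e
  have : j = j' := Sum.inr.inj (he.symm.trans h')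
  exact this ▸ hj'

theorem isLoop_relabel_mul {f : Fin m ↪ Fin l} {g : Fin k ↪ Fin l}
    (hfg : ∀ i j, f i ≠ g j) (hcov : ∀ x, x ∈ Set.range f ∨ x ∈ Set.range g)
    (σ : Equiv.Perm (Fin n ⊕ Fin m)) (ρ : Equiv.Perm (Fin n ⊕ Fin k)) :
    {s | IsLoop (relabelPerm n f σ * relabelPerm n g ρ) s} =
      Set.image f '' {t | IsLoop σ t} ∪ Set.image g '' {t | IsLoop ρ t} := by
  have hf : ∀ i, (relabelPerm n f σ * relabelPerm n g ρ) (Sum.inr (f i)) =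
      (σ (Sum.inr i)).map id f := fun i => by
    rw [Equiv.Perm.mul_apply, relabelPerm_of_notMem g ρ
      (by rintro ⟨j, hj⟩; exact hfg i j hj.symm), relabelPerm_inr]
  have hfix : ∀ j, relabelPerm n f σ (Sum.inr (g j)) = Sum.inr (g j) := fun j =>
    relabelPerm_of_notMem f σ (by rintro ⟨i, hi⟩; exact hfg i j hi)
  have hg : ∀ j j', (relabelPerm n f σ * relabelPerm n g ρ) (Sum.inr (g j)) = Sum.inr (g j') ↔
      ρ (Sum.inr j) = Sum.inr j' := fun j j' => by
    rw [Equiv.Perm.mul_apply, relabelPerm_inr, ← hfix j', (relabelPerm n f σ).injective.eq_iff]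
    rcases ρ (Sum.inr j) with a | i <;> simp
  ext s
  constructor
  · intro hs
    obtain ⟨x, hx⟩ := hs.1
    by_cases hxf : ∃ i, f i ∈ s
    · obtain ⟨i, hi⟩ := hxf
      have hsub : s ⊆ Set.range f := by
        refine hs.subset hi ⟨i, rfl⟩ ?_
        rintro _ - ⟨i, rfl⟩ j hj
        rw [hf] at hj
        rcases h : σ (Sum.inr i) with a | i'
        · simp [h] at hj
        · rw [h] at hj
          exact ⟨i', Sum.inr.inj hj⟩
      refine Or.inl ⟨f ⁻¹' s, ?_, Set.image_preimage_eq_of_subset hsub⟩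
      rw [Set.mem_ofPred_eq, ← isLoop_image_iff (n' := n)
        (ψ := relabelPerm n f σ * relabelPerm n g ρ) f, Set.image_preimage_eq_of_subset hsub]
      · exact hs
      · intro i hi
        obtain ⟨j, hj, h⟩ := hs.exists_apply hi
        obtain ⟨j, rfl⟩ := hsub hj
        refine ⟨j, hj, ?_, h⟩
        rw [hf] at h
        rcases h' : σ (Sum.inr i) with a | i'
        · simp [h'] at h
        · rw [h'] at h
          rw [f.injective (Sum.inr.inj h)]
    · have hsub : s ⊆ Set.range g := fun x hx => (hcov x).resolve_left (by
        rintro ⟨i, rfl⟩; exact hxf ⟨i, hx⟩)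
      refine Or.inr ⟨g ⁻¹' s, ?_, Set.image_preimage_eq_of_subset hsub⟩
      rw [Set.mem_ofPred_eq, ← isLoop_image_iff (n' := n)
        (ψ := relabelPerm n f σ * relabelPerm n g ρ) g, Set.image_preimage_eq_of_subset hsub]
      · exact hs
      · intro i hi
        obtain ⟨j, hj, h⟩ := hs.exists_apply hi
        obtain ⟨j, rfl⟩ := hsub hj
        exact ⟨j, hj, (hg _ _).mp h, h⟩
  · rintro (⟨t, ht, rfl⟩ | ⟨t, ht, rfl⟩)
    · refine (isLoop_image_iff f t fun i hi => ?_).mpr ht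
      obtain ⟨j, hj, h⟩ := IsLoop.exists_apply ht hi
      exact ⟨j, hj, h, by rw [hf, h]; rfl⟩
    · refine (isLoop_image_iff g t fun i hi => ?_).mpr ht
      obtain ⟨j, hj, h⟩ := IsLoop.exists_apply ht hi
      exact ⟨j, hj, h, (hg _ _).mpr h⟩

theorem ncard_isLoop_relabel_mul {f : Fin m ↪ Fin l} {g : Fin k ↪ Fin l}
    (hfg : ∀ i j, f i ≠ g j) (hcov : ∀ x, x ∈ Set.range f ∨ x ∈ Set.range g)
    (σ : Equiv.Perm (Fin n ⊕ Fin m)) (ρ : Equiv.Perm (Fin n ⊕ Fin k)) :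
    {s | IsLoop (relabelPerm n f σ * relabelPerm n g ρ) s}.ncard =
      {t | IsLoop σ t}.ncard + {t | IsLoop ρ t}.ncard := by
  rw [isLoop_relabel_mul hfg hcov, Set.ncard_union_eq _ (Set.toFinite _) (Set.toFinite _),
    Set.ncard_image_of_injective _ (Set.image_injective.mpr f.injective),
    Set.ncard_image_of_injective _ (Set.image_injective.mpr g.injective)]
  rw [Set.disjoint_left]
  rintro _ ⟨t, ht, rfl⟩ ⟨t', -, h⟩
  obtain ⟨i, hi⟩ := ht.1
  have : f i ∈ g '' t' := h ▸ ⟨i, hi, rfl⟩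
  obtain ⟨j, -, hj⟩ := this
  exact hfg i j hj.symm

/-- The embedding `C[S_{n+m}] → C[S_{n+l}]` that relabels the symbols `> n`. -/
def relabelAlg (n : ℕ) {m l : ℕ} (f : Fin m ↪ Fin l) :
    GroupAlg (Fin n ⊕ Fin m) →ₐ[ℂ] GroupAlg (Fin n ⊕ Fin l) :=
  MonoidAlgebra.mapDomainAlgHom ℂ ℂ (relabelPerm n f)

theorem relabelAlg_perm (f : Fin m ↪ Fin l) (σ : Equiv.Perm (Fin n ⊕ Fin m)) :
    relabelAlg n f (perm σ) = perm (relabelPerm n f σ) := by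
  simp [relabelAlg, perm]

theorem shift_perm (π : Equiv.Perm (Fin m)) :
    shift n m (perm π) = perm (Equiv.Perm.sumCongrHom (Fin n) (Fin m) (1, π)) := by
  simp [shift, perm]

theorem perm_mul {α : Type} (σ τ : Equiv.Perm α) : perm (σ * τ) = perm σ * perm τ := by
  simp [perm, MonoidAlgebra.single_mul_single]

theorem perm_one {α : Type} : perm (1 : Equiv.Perm α) = 1 := rfl

theorem groupAlg_induction {α : Type} {motive : GroupAlg α → Prop} (x : GroupAlg α)
    (zero : motive 0) (add : ∀ x y, motive x → motive y → motive (x + y))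
    (smul : ∀ (c : ℂ) (σ : Equiv.Perm α), motive (c • perm σ)) : motive x := by
  induction x using MonoidAlgebra.induction_linear with
  | zero => exact zero
  | add x y hx hy => exact add x y hx hy
  | single σ c => simpa [perm] using smul c σ

/-- Partial traces over disjoint sets of symbols are multiplicative. -/
theorem partialTrace_relabel_mul {f : Fin m ↪ Fin l} {g : Fin k ↪ Fin l}
    (hfg : ∀ i j, f i ≠ g j) (hcov : ∀ x, x ∈ Set.range f ∨ x ∈ Set.range g) (p : ℂ)
    (x : GroupAlg (Fin n ⊕ Fin m)) (y : GroupAlg (Fin n ⊕ Fin k)) :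
    partialTrace n l p (relabelAlg n f x * relabelAlg n g y) =
      partialTrace n m p x * partialTrace n k p y := by
  induction x using groupAlg_induction with
  | zero => simp
  | add x x' hx hx' => simp only [map_add, add_mul, hx, hx']
  | smul c σ =>
    induction y using groupAlg_induction with
    | zero => simp
    | add y y' hy hy' => simp only [map_add, mul_add, hy, hy']
    | smul d ρ =>
      simp only [map_smul, smul_mul_assoc, mul_smul_comm, relabelAlg_perm, ← perm_mul,
        partialTrace_perm_eq, removeLast_relabel_mul hfg, ncard_isLoop_relabel_mul hfg hcov,
        pow_add, smul_smul]
      congr 1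
      ring

end relabel

section cyclic

variable {n m : ℕ}

theorem path_conj (π : Equiv.Perm (Fin m)) (σ : Equiv.Perm (Fin n ⊕ Fin m))
    {x : Fin n ⊕ Fin m} {b : Fin n} (h : Path σ x b) :
    Path (Equiv.Perm.sumCongrHom (Fin n) (Fin m) (1, π) * σ *
      (Equiv.Perm.sumCongrHom (Fin n) (Fin m) (1, π))⁻¹)
      (Equiv.Perm.sumCongrHom (Fin n) (Fin m) (1, π) x) b := by
  induction h with
  | last h => exact Path.last (by simp [h])
  | @step x i b h _ ih => exact Path.step (i := π i) (by simp [h]) (by simpa using ih)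

theorem removeLast_conj (π : Equiv.Perm (Fin m)) (σ : Equiv.Perm (Fin n ⊕ Fin m)) :
    removeLast (Equiv.Perm.sumCongrHom (Fin n) (Fin m) (1, π) * σ *
      (Equiv.Perm.sumCongrHom (Fin n) (Fin m) (1, π))⁻¹) = removeLast σ :=
  removeLast_eq_of_path fun a => by simpa using path_conj π σ (path_removeLast σ a)

theorem IsLoop.conj {π : Equiv.Perm (Fin m)} {σ : Equiv.Perm (Fin n ⊕ Fin m)} {t : Set (Fin m)}
    (ht : IsLoop σ t) : IsLoop (Equiv.Perm.sumCongrHom (Fin n) (Fin m) (1, π) * σ *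
      (Equiv.Perm.sumCongrHom (Fin n) (Fin m) (1, π))⁻¹) (π.toEmbedding '' t) := by
  refine (isLoop_image_iff π.toEmbedding t fun i hi => ?_).mpr ht
  obtain ⟨j, hj, h⟩ := ht.exists_apply hi
  exact ⟨j, hj, h, by simp [h]⟩

theorem ncard_isLoop_conj_le (π : Equiv.Perm (Fin m)) (σ : Equiv.Perm (Fin n ⊕ Fin m)) :
    {t | IsLoop σ t}.ncard ≤ {t | IsLoop (Equiv.Perm.sumCongrHom (Fin n) (Fin m) (1, π) * σ *
      (Equiv.Perm.sumCongrHom (Fin n) (Fin m) (1, π))⁻¹) t}.ncard :=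
  Set.ncard_le_ncard_of_injOn (Set.image π.toEmbedding) (fun _ ht => IsLoop.conj ht)
    (Set.image_injective.mpr π.toEmbedding.injective).injOn (Set.toFinite _)

theorem ncard_isLoop_conj (π : Equiv.Perm (Fin m)) (σ : Equiv.Perm (Fin n ⊕ Fin m)) :
    {t | IsLoop (Equiv.Perm.sumCongrHom (Fin n) (Fin m) (1, π) * σ *
      (Equiv.Perm.sumCongrHom (Fin n) (Fin m) (1, π))⁻¹) t}.ncard = {t | IsLoop σ t}.ncard := by
  refine le_antisymm ?_ (ncard_isLoop_conj_le π σ)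
  refine (ncard_isLoop_conj_le π⁻¹ _).trans_eq ?_
  have : ((1, π⁻¹) : Equiv.Perm (Fin n) × Equiv.Perm (Fin m)) = (1, π)⁻¹ := by simp
  rw [this, map_inv]
  congr! 4
  group

/-- The partial trace is cyclic with respect to the symbols `> n`. -/
theorem partialTrace_mul_shift (p : ℂ) (x : GroupAlg (Fin n ⊕ Fin m)) (y : GroupAlg (Fin m)) :
    partialTrace n m p (x * shift n m y) = partialTrace n m p (shift n m y * x) := by
  induction x using groupAlg_induction with
  | zero => simp
  | add x x' hx hx' => simp only [map_add, add_mul, mul_add, hx, hx']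
  | smul c σ =>
    induction y using groupAlg_induction with
    | zero => simp
    | add y y' hy hy' => simp only [map_add, add_mul, mul_add, hy, hy']
    | smul d π =>
      have h1 := removeLast_conj π (σ * Equiv.Perm.sumCongrHom (Fin n) (Fin m) (1, π))
      have h2 := ncard_isLoop_conj π (σ * Equiv.Perm.sumCongrHom (Fin n) (Fin m) (1, π))
      rw [← mul_assoc, mul_inv_cancel_right] at h1 h2
      simp only [map_smul, smul_mul_assoc, mul_smul_comm, shift_perm, ← perm_mul,
        partialTrace_perm_eq, h1, h2, smul_comm c d]

end cyclic

/-! ### Exchange relations for transpositions -/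

section ring

variable {𝒜 : Type*} [Ring 𝒜]

theorem mul_list_prod_semiconj {ι : Type*} {R : 𝒜} {x y : ι → 𝒜} (l : List ι)
    (h : ∀ a ∈ l, R * x a = y a * R) : R * (l.map x).prod = (l.map y).prod * R := by
  induction l with
  | nil => simp
  | cons a l ih =>
    rw [List.map_cons, List.map_cons, List.prod_cons, List.prod_cons, ← mul_assoc,
      h a List.mem_cons_self, mul_assoc, ih fun b hb => h b (List.mem_cons_of_mem _ hb), mul_assoc]

theorem list_prod_mul_list_prod {ι : Type*} {x y : ι → 𝒜} {l : List ι} (hl : l.Nodup)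
    (h : ∀ a ∈ l, ∀ b ∈ l, a ≠ b → Commute (x a) (y b)) :
    (l.map x).prod * (l.map y).prod = (l.map fun a => x a * y a).prod := by
  induction l with
  | nil => simp
  | cons a l ih =>
    simp only [List.map_cons, List.prod_cons]
    rw [List.nodup_cons] at hl
    have hc : Commute (l.map x).prod (y a) := by
      refine Commute.list_prod_left _ _ ?_
      simp only [List.mem_map]
      rintro _ ⟨b, hb, rfl⟩
      exact h b (List.mem_cons_of_mem _ hb) a List.mem_cons_self (by rintro rfl; exact hl.1 hb)
    rw [mul_assoc, ← mul_assoc _ (y a), hc.eq, mul_assoc (y a), ih hl.2 fun b hb c hc =>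
      h b (List.mem_cons_of_mem _ hb) c (List.mem_cons_of_mem _ hc), mul_assoc]

theorem commute_list_map_prod {ι : Type*} {s : 𝒜} {x : ι → 𝒜} {l : List ι}
    (h : ∀ a ∈ l, Commute s (x a)) : Commute s (l.map x).prod := by
  refine Commute.list_prod_right _ _ ?_
  simp only [List.mem_map]
  rintro _ ⟨b, hb, rfl⟩
  exact h b hb

/-- Moving `R_k ⋯ R_1` through `M L_1 ⋯ L_k`. -/
theorem reverse_prod_exchange {ι : Type*} {R L : ι → 𝒜} {M : 𝒜} {l : List ι} (hl : l.Nodup)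
    (h : ∀ j ∈ l, R j * M * L j = L j * M * R j)
    (hc : ∀ i ∈ l, ∀ j ∈ l, i ≠ j → Commute (R i) (L j)) :
    (l.map R).reverse.prod * (M * (l.map L).prod) =
      (l.map L).prod * M * (l.map R).reverse.prod := by
  induction l with
  | nil => simp
  | cons j l ih =>
    rw [List.nodup_cons] at hl
    have ih := ih hl.2 (fun i hi => h i (List.mem_cons_of_mem _ hi))
      (fun i hi i' hi' => hc i (List.mem_cons_of_mem _ hi) i' (List.mem_cons_of_mem _ hi'))
    have h1 : Commute (R j) (l.map L).prod := commute_list_map_prod fun i hi =>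
      hc j List.mem_cons_self i (List.mem_cons_of_mem _ hi) (by rintro rfl; exact hl.1 hi)
    have h2 : Commute (L j) (l.map R).reverse.prod := by
      rw [← List.map_reverse]
      refine commute_list_map_prod fun i hi => (hc i ?_ j List.mem_cons_self ?_).symm
      · exact List.mem_cons_of_mem _ (List.mem_reverse.mp hi)
      · rintro rfl; exact hl.1 (List.mem_reverse.mp hi)
    have h3 := h j List.mem_cons_self
    simp only [List.map_cons, List.prod_cons, List.reverse_cons, List.prod_append, List.prod_nil,
      mul_one]
    calc (l.map R).reverse.prod * R j * (M * (L j * (l.map L).prod))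
        = (l.map R).reverse.prod * (R j * M * L j) * (l.map L).prod := by simp only [mul_assoc]
      _ = (l.map R).reverse.prod * L j * M * (R j * (l.map L).prod) := by
        rw [h3]; simp only [mul_assoc]
      _ = L j * ((l.map R).reverse.prod * (M * (l.map L).prod)) * R j := by
        rw [h1.eq, ← h2.eq]; simp only [mul_assoc]
      _ = L j * (l.map L).prod * M * ((l.map R).reverse.prod * R j) := by
        rw [ih]; simp only [mul_assoc]

variable [Algebra ℂ 𝒜]

/-- The Yang–Baxter exchange relation. -/
theorem exchange {σ S S' : 𝒜} (h1 : σ * S = S' * σ) (h2 : σ * S' = S * σ)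
    (h3 : S * S' - S' * S = (S' - S) * σ) (ħ x y c : ℂ) (hc : c = x - y) :
    (c • 1 + ħ • S) * (x • 1 + ħ • S') * (y • 1 + ħ • σ) =
      (y • 1 + ħ • σ) * (x • 1 + ħ • S') * (c • 1 + ħ • S) := by
  subst hc
  have h4 : σ * S' * S = S * S' * σ := by rw [h2, mul_assoc, h1, mul_assoc]
  simp only [add_mul, mul_add, smul_mul_assoc, mul_smul_comm, one_mul, mul_one, smul_add, sub_mul]
    at h3 ⊢
  rw [h4, h1, h2]
  linear_combination (norm := module) (y * ħ ^ 2) • h3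

theorem mul_list_prod_smul {ι : Type*} {A : 𝒜} {x y : ι → 𝒜} {c : ι → ℂ} (l : List ι)
    (h : ∀ a ∈ l, A * x a = c a • (y a * A)) :
    A * (l.map x).prod = (l.map c).prod • ((l.map y).prod * A) := by
  induction l with
  | nil => simp
  | cons a l ih =>
    simp only [List.map_cons, List.prod_cons]
    rw [← mul_assoc, h a List.mem_cons_self, smul_mul_assoc, mul_assoc,
      ih fun b hb => h b (List.mem_cons_of_mem _ hb), mul_smul_comm, smul_smul, mul_assoc]

/-- In a finite-dimensional algebra, a left ideal `𝒜 A` stable under right multiplication by a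
unit is stable under right multiplication by its inverse. -/
theorem mul_inv_mul_of_stable [FiniteDimensional ℂ 𝒜] {A R R' : 𝒜} (hA : A * A = A)
    (hAR : A * R * A = A * R) (hR : R * R' = 1) : A * R' * A = A * R' := by
  let V : Submodule ℂ 𝒜 := LinearMap.range (LinearMap.mulRight ℂ A)
  have hV : ∀ y ∈ V, y * A = y := by
    rintro _ ⟨y, rfl⟩
    simp [mul_assoc, hA]
  have hmap : ∀ y ∈ V, LinearMap.mulRight ℂ R y ∈ V := fun y hy =>
    ⟨y * R, by
      rw [LinearMap.mulRight_apply, LinearMap.mulRight_apply, ← hV y hy, mul_assoc y A R,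
        mul_assoc y, hAR]⟩
  let F : V →ₗ[ℂ] V := (LinearMap.mulRight ℂ R).restrict hmap
  have hF : Function.Injective F := by
    intro y y' h
    have h' : (y : 𝒜) * R = y' * R := congrArg Subtype.val h
    have := congrArg (· * R') h'
    simp only [mul_assoc, hR, mul_one] at this
    exact Subtype.ext this
  obtain ⟨y, hy⟩ := (LinearMap.injective_iff_surjective.mp hF) ⟨A, A, by simp [hA]⟩
  have hy' : (y : 𝒜) * R = A := congrArg Subtype.val hy
  have : A * R' = y := by rw [← hy', mul_assoc, hR, mul_one]
  rw [this, hV _ y.2]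

/-- The commutation of transfer matrices up to cyclicity, from an intertwiner `R`. -/
theorem trace_exchange [FiniteDimensional ℂ 𝒜] {V : Type*} [AddCommGroup V] [Module ℂ V]
    (t : 𝒜 →ₗ[ℂ] V) (Z : Subalgebra ℂ 𝒜) (ht : ∀ y ∈ Z, ∀ x, t (x * y) = t (y * x))
    {A B R R' W W' U U' : 𝒜} {c : ℂ} (hc : c ≠ 0) (hAZ : A ∈ Z) (hBZ : B ∈ Z) (hRZ : R ∈ Z)
    (hA : A * A = A) (hAR : A * R * A = A * R) (hR : R * R' = 1) (hR' : R' * R = 1)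
    (hBA : Commute B A) (hBR : Commute B R) (hW : A * W = c • (U * A))
    (hW' : A * W' = c • (U' * A)) (hU : Commute A U) (hU' : Commute A U')
    (hRW : R * W = W' * R) : t (B * A * U) = t (B * A * U') := by
  have hW'' : W' = R * W * R' := by rw [hRW, mul_assoc, hR, mul_one]
  have hAR' := mul_inv_mul_of_stable hA hAR hR
  have h1 : B * A * W' = c • (B * A * R * (U * A * R')) := by
    calc B * A * W' = B * (A * R) * W * R' := by rw [hW'']; simp only [mul_assoc]
      _ = B * (A * R) * (A * W) * R' := by nth_rw 1 [← hAR]; simp only [mul_assoc]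
      _ = c • (B * (A * R) * (U * A) * R') := by rw [hW, mul_smul_comm, smul_mul_assoc]
      _ = _ := by simp only [mul_assoc]
  have h2 : U * A * R' * (B * A * R) = A * U * B := by
    calc U * A * R' * (B * A * R) = U * (A * R' * A) * (B * R) := by
          rw [hBA.eq]; simp only [mul_assoc]
      _ = U * A * (R' * R) * B := by rw [hAR', hBR.eq]; simp only [mul_assoc]
      _ = A * U * B := by rw [hR', hU.eq, mul_one]
  have h3 : c • t (B * A * U') = c • t (B * A * U) := by
    calc c • t (B * A * U') = t (B * A * W') := by
          rw [mul_assoc B A W', hW', ← hU'.eq, mul_smul_comm, map_smul, mul_assoc]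
      _ = c • t (U * A * R' * (B * A * R)) := by
          rw [h1, map_smul, ht _ (Z.mul_mem (Z.mul_mem hBZ hAZ) hRZ)]
      _ = c • t (B * A * U) := by rw [h2, ht _ hBZ, mul_assoc]
  exact (smul_right_injective V hc h3).symm

theorem finite_spectrum_of_finiteDimensional [FiniteDimensional ℂ 𝒜] (a : 𝒜) :
    (spectrum ℂ a).Finite := by
  rcases subsingleton_or_nontrivial 𝒜 with h | h
  · simp [spectrum.of_subsingleton]
  refine ((minpoly ℂ a).rootSet_finite ℂ).subset fun x hx => ?_
  have hi : IsIntegral ℂ a := Algebra.IsIntegral.isIntegral a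
  rw [Polynomial.mem_rootSet]
  refine ⟨minpoly.ne_zero hi, ?_⟩
  have := spectrum.subset_polynomial_aeval a (minpoly ℂ a) ⟨x, hx, rfl⟩
  rw [minpoly.aeval, spectrum.zero_eq] at this
  simpa [Polynomial.aeval_def] using this

end ring

/-- The exchange relation at the parameter where the third factor is proportional to `1 + σ`. -/
theorem exchange_symm {𝒜 : Type*} [Ring 𝒜] [Algebra ℂ 𝒜] {σ S S' : 𝒜}
    (h1 : σ * S = S' * σ) (h2 : σ * S' = S * σ)
    (h3 : S * S' - S' * S = (S' - S) * σ) (ħ x y : ℂ) (hy : y = x - ħ) :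
    (1 + σ) * ((x • 1 + ħ • S) * (y • 1 + ħ • S')) =
      (y • 1 + ħ • S') * (x • 1 + ħ • S) * (1 + σ) := by
  subst hy
  have h4 : σ * (S * S') = S' * S * σ := by rw [← mul_assoc, h1, mul_assoc, h2, mul_assoc]
  simp only [add_mul, mul_add, smul_mul_assoc, mul_smul_comm, one_mul, mul_one, smul_add, sub_mul]
    at h3 ⊢
  rw [h4, h1, h2]
  linear_combination (norm := module) (ħ ^ 2) • h3

instance {α : Type} [Finite α] : FiniteDimensional ℂ (GroupAlg α) :=
  Module.Finite.equiv (MonoidAlgebra.coeffLinearEquiv ℂ).symm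

/-! ### The antisymmetrizer -/

theorem antisymmetrizer_mul_perm {k : ℕ} (π : Equiv.Perm (Fin k)) :
    antisymmetrizer k * perm π = ((Equiv.Perm.sign π : ℤ) : ℂ) • antisymmetrizer k := by
  rw [antisymmetrizer, smul_mul_assoc, smul_comm, Finset.sum_mul]
  refine congrArg _ ?_
  rw [Finset.smul_sum]
  refine Fintype.sum_equiv (Equiv.mulRight π) _ _ fun (σ : Equiv.Perm (Fin k)) => ?_
  rw [smul_mul_assoc, ← perm_mul, smul_smul, Equiv.coe_mulRight, map_mul, Units.val_mul,
    Int.cast_mul, mul_left_comm, ← Int.cast_mul]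
  simp

/-- An element that is alternating under adjacent transpositions absorbs the antisymmetrizer. -/
theorem mul_map_antisymmetrizer {𝒜 : Type*} [Ring 𝒜] [Algebra ℂ 𝒜] {r : ℕ}
    (ψ : GroupAlg (Fin (r + 1)) →ₐ[ℂ] 𝒜) {y : 𝒜}
    (h : ∀ j : Fin r, y * ψ (perm (Equiv.swap j.castSucc j.succ)) = -y) :
    y * ψ (antisymmetrizer (r + 1)) = y := by
  have key : ∀ π : Equiv.Perm (Fin (r + 1)),
      y * ψ (perm π) = ((Equiv.Perm.sign π : ℤ) : ℂ) • y := by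
    intro π
    have hπ : π ∈ Submonoid.closure
        (Set.range fun i : Fin r => Equiv.swap i.castSucc i.succ) := by
      rw [Equiv.Perm.mclosure_swap_castSucc_succ]; trivial
    induction hπ using Submonoid.closure_induction with
    | mem π hπ =>
      obtain ⟨j, rfl⟩ := hπ
      rw [h, Equiv.Perm.sign_swap (Fin.castSucc_lt_succ).ne]
      simp
    | one => simp [perm_one]
    | mul π ρ _ _ hπ hρ =>
      rw [perm_mul, map_mul, ← mul_assoc, hπ, smul_mul_assoc, hρ, smul_smul, map_mul,
        Units.val_mul, Int.cast_mul]
  rw [antisymmetrizer, map_smul, map_sum, mul_smul_comm, Finset.mul_sum]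
  have : ∀ π : Equiv.Perm (Fin (r + 1)),
      y * ψ (((Equiv.Perm.sign π : ℤ) : ℂ) • perm π) = y := by
    intro π
    rw [map_smul, mul_smul_comm, key, smul_smul, ← Int.cast_mul]
    simp
  rw [Finset.sum_congr rfl fun π _ => this π, Finset.sum_const, Finset.card_univ,
    Fintype.card_perm, Fintype.card_fin, ← Nat.cast_smul_eq_nsmul ℂ, smul_smul,
    inv_mul_cancel₀ (by exact_mod_cast Nat.factorial_ne_zero _), one_smul]

theorem antisymmetrizer_mul_self {k : ℕ} :
    antisymmetrizer k * antisymmetrizer k = antisymmetrizer k := by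
  conv_lhs => enter [2]; rw [antisymmetrizer]
  rw [mul_smul_comm, Finset.mul_sum]
  have : ∀ π : Equiv.Perm (Fin k),
      antisymmetrizer k * (((Equiv.Perm.sign π : ℤ) : ℂ) • perm π) = antisymmetrizer k := by
    intro π
    rw [mul_smul_comm, antisymmetrizer_mul_perm, smul_smul, ← Int.cast_mul]
    simp
  rw [Finset.sum_congr rfl fun π _ => this π, Finset.sum_const, Finset.card_univ,
    Fintype.card_perm, Fintype.card_fin, ← Nat.cast_smul_eq_nsmul ℂ, smul_smul,
    inv_mul_cancel₀ (by exact_mod_cast Nat.factorial_ne_zero _), one_smul]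

theorem commute_map_of_commute_perm {𝒜 : Type*} [Ring 𝒜] [Algebra ℂ 𝒜] {α : Type}
    (ψ : GroupAlg α →ₐ[ℂ] 𝒜) {y : 𝒜} (h : ∀ π, Commute (ψ (perm π)) y) (x : GroupAlg α) :
    Commute (ψ x) y := by
  induction x using groupAlg_induction with
  | zero => simp
  | add x x' hx hx' => rw [map_add]; exact hx.add_left hx'
  | smul c σ => rw [map_smul]; exact (h σ).smul_left c

/-! ### Transpositions -/

section swap

variable {α : Type} [DecidableEq α]

theorem perm_mul_swap (π : Equiv.Perm α) (x y : α) :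
    perm π * perm (Equiv.swap x y) = perm (Equiv.swap (π x) (π y)) * perm π := by
  rw [← perm_mul, ← perm_mul, Equiv.mul_swap_eq_swap_mul]

theorem commute_perm_swap {π : Equiv.Perm α} {x y : α} (hx : π x = x) (hy : π y = y) :
    Commute (perm π) (perm (Equiv.swap x y)) := by
  rw [Commute, SemiconjBy, perm_mul_swap, hx, hy]

theorem swap_mul_swap_of_ne {x y z : α} (hxy : x ≠ y) (hxz : x ≠ z) :
    perm (Equiv.swap x z) * perm (Equiv.swap y z) =
      perm (Equiv.swap y z) * perm (Equiv.swap x y) := by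
  rw [perm_mul_swap (Equiv.swap y z) x y, Equiv.swap_apply_left,
    Equiv.swap_apply_of_ne_of_ne hxy hxz]

variable {ι : Type} [Fintype ι]

/-- The sum of the transpositions of `x` with the symbols `f i`. -/
def starSum (f : ι → α) (x : α) : GroupAlg α := ∑ i, perm (Equiv.swap x (f i))

theorem perm_mul_starSum {f : ι → α} {π : Equiv.Perm α} {ρ : Equiv.Perm ι}
    (h : ∀ i, π (f i) = f (ρ i)) (x : α) :
    perm π * starSum f x = starSum f (π x) * perm π := by
  rw [starSum, starSum, Finset.mul_sum, Finset.sum_mul]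
  refine Fintype.sum_equiv ρ _ _ fun i => ?_
  rw [perm_mul_swap, h]

theorem swap_mul_starSum {f : ι → α} {x y : α} (hx : ∀ i, f i ≠ x) (hy : ∀ i, f i ≠ y) :
    perm (Equiv.swap x y) * starSum f x = starSum f y * perm (Equiv.swap x y) := by
  have := perm_mul_starSum (f := f) (π := Equiv.swap x y) (ρ := 1)
    (fun i => Equiv.swap_apply_of_ne_of_ne (hx i) (hy i)) x
  rwa [Equiv.swap_apply_left] at this

theorem starSum_commutator {f : ι → α} (hf : Function.Injective f) {x y : α} (hxy : x ≠ y)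
    (hx : ∀ i, f i ≠ x) (hy : ∀ i, f i ≠ y) :
    starSum f x * starSum f y - starSum f y * starSum f x =
      (starSum f y - starSum f x) * perm (Equiv.swap x y) := by
  have h1 : ∀ i, ∑ j, (perm (Equiv.swap x (f i)) * perm (Equiv.swap y (f j)) -
      perm (Equiv.swap y (f j)) * perm (Equiv.swap x (f i))) =
      perm (Equiv.swap y (f i)) * perm (Equiv.swap x y) -
        perm (Equiv.swap x (f i)) * perm (Equiv.swap x y) := by
    intro i
    rw [Finset.sum_eq_single i]
    · rw [swap_mul_swap_of_ne hxy (hx i).symm, swap_mul_swap_of_ne hxy.symm (hy i).symm,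
        Equiv.swap_comm y x]
    · intro j _ hj
      have : Commute (perm (Equiv.swap x (f i))) (perm (Equiv.swap y (f j))) :=
        commute_perm_swap (Equiv.swap_apply_of_ne_of_ne hxy.symm (hy i).symm)
          (Equiv.swap_apply_of_ne_of_ne (hx j) (hf.ne hj))
      rw [this.eq, sub_self]
    · simp
  have h2 : starSum f y * starSum f x =
      ∑ i, ∑ j, perm (Equiv.swap y (f j)) * perm (Equiv.swap x (f i)) := by
    rw [starSum, starSum, Finset.sum_mul_sum, Finset.sum_comm]
  rw [h2, sub_mul, starSum, starSum, Finset.sum_mul_sum, ← Finset.sum_sub_distrib]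
  simp only [← Finset.sum_sub_distrib]
  rw [Finset.sum_congr rfl fun i _ => h1 i, Finset.sum_sub_distrib, Finset.sum_mul,
    Finset.sum_mul]

/-- Fusion: under an alternating element, an ordered product of linear factors with parameters in
arithmetic progression collapses to a single linear factor. -/
theorem fusion (A : GroupAlg α) (x : α) (ħ w : ℂ) {r : ℕ} (G : Fin (r + 1) → α)
    (hG : Function.Injective G) (hx : ∀ j, G j ≠ x)
    (hA : ∀ i j, i ≠ j → A * perm (Equiv.swap (G i) (G j)) = -A) :
    A * (List.ofFn fun j => (w + (j : ℕ) * ħ) • (1 : GroupAlg α) +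
        ħ • perm (Equiv.swap x (G j))).prod =
      (∏ j : Fin r, (w + (j : ℕ) * ħ)) • (A * ((w + r * ħ) • 1 + ħ • starSum G x)) := by
  induction r with
  | zero => simp [starSum]
  | succ r ih =>
    have hAS : A * starSum (fun j : Fin (r + 1) => G j.castSucc) x *
        perm (Equiv.swap x (G (Fin.last (r + 1)))) =
        -(A * starSum (fun j : Fin (r + 1) => G j.castSucc) x) := by
      rw [starSum, Finset.mul_sum, Finset.sum_mul, ← Finset.sum_neg_distrib]
      refine Finset.sum_congr rfl fun j _ => ?_
      have hne : G j.castSucc ≠ G (Fin.last (r + 1)) := hG.ne (Fin.castSucc_lt_last j).ne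
      rw [mul_assoc, perm_mul_swap, Equiv.swap_apply_left,
        Equiv.swap_apply_of_ne_of_ne (hx _) hne.symm, ← mul_assoc,
        hA _ _ (Fin.castSucc_lt_last j).ne, neg_mul]
    have hS : starSum G x = starSum (fun j : Fin (r + 1) => G j.castSucc) x +
        perm (Equiv.swap x (G (Fin.last (r + 1)))) := by
      rw [starSum, starSum, Fin.sum_univ_castSucc]
    have ih := ih (fun j => G j.castSucc) (hG.comp (Fin.castSucc_injective _)) (fun j => hx _)
      (fun i j hij => hA _ _ ((Fin.castSucc_injective _).ne hij))
    simp only [List.ofFn_succ' (n := r + 1), List.concat_eq_append, List.prod_append,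
      List.prod_singleton, Fin.val_castSucc, Fin.val_last]
    rw [← mul_assoc, ih, smul_mul_assoc, Fin.prod_univ_castSucc]
    simp only [Fin.val_castSucc, Fin.val_last]
    rw [mul_smul]
    congr 1
    rw [hS]
    push_cast
    simp only [mul_add, add_mul, mul_smul_comm, smul_mul_assoc, mul_one, hAS]
    module

end swap

/-! ### Permutations of the symbols `> n` -/

section tail

variable {n m k l : ℕ}

/-- The permutation of `Fin n ⊕ Fin l` that permutes the symbols in the range of `g`. -/
def tailPerm (n : ℕ) (g : Fin k ↪ Fin l) (π : Equiv.Perm (Fin k)) :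
    Equiv.Perm (Fin n ⊕ Fin l) :=
  Equiv.Perm.sumCongrHom (Fin n) (Fin l) (1, Equiv.Perm.viaEmbeddingHom g π)

theorem tailPerm_inl (g : Fin k ↪ Fin l) (π : Equiv.Perm (Fin k)) (a : Fin n) :
    tailPerm n g π (Sum.inl a) = Sum.inl a := rfl

theorem tailPerm_inr (g : Fin k ↪ Fin l) (π : Equiv.Perm (Fin k)) (j : Fin k) :
    tailPerm n g π (Sum.inr (g j)) = Sum.inr (g (π j)) :=
  congrArg Sum.inr (Equiv.Perm.viaEmbedding_apply π g j)

theorem tailPerm_inr_of_notMem (g : Fin k ↪ Fin l) (π : Equiv.Perm (Fin k)) {i : Fin l}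
    (hi : i ∉ Set.range g) : tailPerm n g π (Sum.inr i) = Sum.inr i :=
  congrArg Sum.inr (Equiv.Perm.viaEmbedding_apply_of_notMem π g i hi)

theorem tailPerm_swap (g : Fin k ↪ Fin l) (i j : Fin k) :
    tailPerm n g (Equiv.swap i j) = Equiv.swap (Sum.inr (g i)) (Sum.inr (g j)) := by
  ext1 x
  rcases x with a | x
  · rw [tailPerm_inl, Equiv.swap_apply_of_ne_of_ne] <;> simp
  · by_cases hx : x ∈ Set.range g
    · obtain ⟨e, rfl⟩ := hx
      rw [tailPerm_inr]
      exact (Sum.inr_injective (α := Fin n)|>.comp g.injective).map_swap i j e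
    · rw [tailPerm_inr_of_notMem g _ hx, Equiv.swap_apply_of_ne_of_ne] <;>
        · intro h
          exact hx ⟨_, (Sum.inr.inj h).symm⟩

/-- The embedding `C[S_k] → C[S_{n+l}]` given by `g : Fin k ↪ Fin l`. -/
def tailAlg (n : ℕ) (g : Fin k ↪ Fin l) : GroupAlg (Fin k) →ₐ[ℂ] GroupAlg (Fin n ⊕ Fin l) :=
  (shift n l).comp (MonoidAlgebra.mapDomainAlgHom ℂ ℂ (Equiv.Perm.viaEmbeddingHom g))

theorem tailAlg_perm (g : Fin k ↪ Fin l) (π : Equiv.Perm (Fin k)) :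
    tailAlg n g (perm π) = perm (tailPerm n g π) := by
  have : (MonoidAlgebra.mapDomainAlgHom ℂ ℂ (Equiv.Perm.viaEmbeddingHom g)) (perm π) =
      perm (Equiv.Perm.viaEmbeddingHom g π) := by simp [perm]
  rw [tailAlg, AlgHom.comp_apply, this, shift_perm, tailPerm]

theorem tailAlg_mem_range (g : Fin k ↪ Fin l) (x : GroupAlg (Fin k)) :
    tailAlg n g x ∈ (shift n l).range :=
  ⟨_, rfl⟩

theorem relabelAlg_shift (g : Fin k ↪ Fin l) (x : GroupAlg (Fin k)) :
    relabelAlg n g (shift n k x) = tailAlg n g x := by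
  induction x using groupAlg_induction with
  | zero => simp
  | add x y hx hy => simp only [map_add, hx, hy]
  | smul c π =>
    rw [map_smul, map_smul, map_smul, shift_perm, relabelAlg_perm, tailAlg_perm]
    congr 2
    ext1 x
    rcases x with a | x
    · rw [relabelPerm_inl, tailPerm_inl]; rfl
    · by_cases hx : x ∈ Set.range g
      · obtain ⟨e, rfl⟩ := hx
        rw [relabelPerm_inr, tailPerm_inr]; rfl
      · rw [relabelPerm_of_notMem g _ hx, tailPerm_inr_of_notMem g _ hx]

/-- The factor `x + ħ ∑_i σ_{y,n+f(i)}`. -/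
def linFactor (ħ : ℂ) (f : Fin m ↪ Fin l) (x : ℂ) (y : Fin n ⊕ Fin l) :
    GroupAlg (Fin n ⊕ Fin l) :=
  x • 1 + ħ • starSum (fun i => Sum.inr (f i)) y

theorem commute_affine {𝒜 : Type*} [Ring 𝒜] [Algebra ℂ 𝒜] {s t : 𝒜} (h : Commute s t)
    (x ħ : ℂ) : Commute s (x • 1 + ħ • t) :=
  ((Commute.one_right s).smul_right x).add_right (h.smul_right ħ)

theorem commute_perm_linFactor {Φ : Equiv.Perm (Fin n ⊕ Fin l)} {ρ : Equiv.Perm (Fin m)}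
    {f : Fin m ↪ Fin l} (h : ∀ i, Φ (Sum.inr (f i)) = Sum.inr (f (ρ i))) {y : Fin n ⊕ Fin l}
    (hy : Φ y = y) (ħ x : ℂ) : Commute (perm Φ) (linFactor ħ f x y) := by
  refine commute_affine ?_ x ħ
  have := perm_mul_starSum (f := fun i => (Sum.inr (f i) : Fin n ⊕ Fin l)) h y
  rwa [hy] at this

theorem commute_linFactor_linFactor {f : Fin m ↪ Fin l} {g : Fin k ↪ Fin l}
    (hfg : ∀ i j, f i ≠ g j) (ħ x y : ℂ) {a b : Fin n} (hab : a ≠ b) :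
    Commute (linFactor ħ f x (Sum.inl a)) (linFactor ħ g y (Sum.inl b)) := by
  refine commute_affine (Commute.sum_right _ _ _ fun j _ => ?_) _ _
  refine (commute_perm_linFactor (ρ := 1) (fun i => ?_) ?_ _ _).symm
  · exact Equiv.swap_apply_of_ne_of_ne (by simp) (by simpa using hfg i j)
  · exact Equiv.swap_apply_of_ne_of_ne (by simpa using hab) (by simp)

theorem commute_tailAlg_linFactor_self (g : Fin k ↪ Fin l) (ħ x : ℂ) (a : Fin n)
    (y : GroupAlg (Fin k)) : Commute (tailAlg n g y) (linFactor ħ g x (Sum.inl a)) :=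
  commute_map_of_commute_perm _ (fun π => by
    rw [tailAlg_perm]
    exact commute_perm_linFactor (ρ := π) (tailPerm_inr g π) rfl _ _) y

theorem commute_tailAlg_linFactor {f : Fin m ↪ Fin l} {g : Fin k ↪ Fin l}
    (hfg : ∀ i j, f i ≠ g j) (ħ x : ℂ) (a : Fin n) (y : GroupAlg (Fin k)) :
    Commute (tailAlg n g y) (linFactor ħ f x (Sum.inl a)) :=
  commute_map_of_commute_perm _ (fun π => by
    rw [tailAlg_perm]
    refine commute_perm_linFactor (ρ := 1) (fun i => ?_) rfl _ _
    exact tailPerm_inr_of_notMem g π (by rintro ⟨j, hj⟩; exact hfg i j hj.symm)) y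

theorem commute_tailAlg_linFactor_inr {f : Fin m ↪ Fin l} {g : Fin k ↪ Fin l}
    (hfg : ∀ i j, f i ≠ g j) (ħ x : ℂ) (j : Fin k) (y : GroupAlg (Fin m)) :
    Commute (tailAlg n f y) (linFactor ħ f x (Sum.inr (g j))) :=
  commute_map_of_commute_perm _ (fun π => by
    rw [tailAlg_perm]
    exact commute_perm_linFactor (ρ := π) (tailPerm_inr f π)
      (tailPerm_inr_of_notMem f π (by rintro ⟨i, hi⟩; exact hfg i j hi)) _ _) y

theorem commute_tailAlg_tailAlg {f : Fin m ↪ Fin l} {g : Fin k ↪ Fin l}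
    (hfg : ∀ i j, f i ≠ g j) (x : GroupAlg (Fin m)) (y : GroupAlg (Fin k)) :
    Commute (tailAlg n f x) (tailAlg n g y) := by
  refine commute_map_of_commute_perm _ (fun π => ?_) x
  refine (commute_map_of_commute_perm _ (fun ρ => ?_) y).symm
  rw [tailAlg_perm, tailAlg_perm, Commute, SemiconjBy, ← perm_mul, ← perm_mul]
  congr 1
  ext1 x
  rw [Equiv.Perm.mul_apply, Equiv.Perm.mul_apply]
  rcases x with a | x
  · rfl
  · by_cases hf : x ∈ Set.range f
    · obtain ⟨i, rfl⟩ := hf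
      have : ∀ i, f i ∉ Set.range g := fun i => by rintro ⟨j, hj⟩; exact hfg i j hj.symm
      rw [tailPerm_inr, tailPerm_inr_of_notMem g _ (this _), tailPerm_inr_of_notMem g _ (this _),
        tailPerm_inr]
    · by_cases hg : x ∈ Set.range g
      · obtain ⟨j, rfl⟩ := hg
        have : ∀ j, g j ∉ Set.range f := fun j => by rintro ⟨i, hi⟩; exact hfg i j hi
        rw [tailPerm_inr, tailPerm_inr_of_notMem f _ (this _), tailPerm_inr_of_notMem f _ (this _),
          tailPerm_inr]
      · rw [tailPerm_inr_of_notMem f _ hf, tailPerm_inr_of_notMem g _ hg,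
          tailPerm_inr_of_notMem f _ hf]

end tail

/-! ### The intertwiner -/

section intertwiner

variable {n m r l : ℕ}

/-- The intertwiner `R_r ⋯ R_0` with `R_j = u - w - j ħ + ħ ∑_i σ_{n+g(j),n+f(i)}`. -/
def intertwiner (n : ℕ) (ħ : ℂ) (f : Fin m ↪ Fin l) (g : Fin (r + 1) ↪ Fin l) (u w : ℂ) :
    GroupAlg (Fin n ⊕ Fin l) :=
  ((List.finRange (r + 1)).map fun j : Fin (r + 1) =>
    linFactor ħ f (u - (w + (j : ℕ) * ħ)) (Sum.inr (g j))).reverse.prod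

theorem starSum_inr_eq_shift (f : Fin m ↪ Fin l) (y : Fin l) :
    starSum (fun i => (Sum.inr (f i) : Fin n ⊕ Fin l)) (Sum.inr y) = shift n l (starSum f y) := by
  rw [starSum, starSum, map_sum]
  refine Finset.sum_congr rfl fun i _ => ?_
  rw [shift_perm]
  congr 1
  ext1 x
  rcases x with a | x
  · exact Equiv.swap_apply_of_ne_of_ne (by simp) (by simp)
  · exact (Sum.inr_injective.map_swap y (f i) x).symm

theorem linFactor_inr_eq_shift (ħ x : ℂ) (f : Fin m ↪ Fin l) (y : Fin l) :
    linFactor ħ f x (Sum.inr y : Fin n ⊕ Fin l) = shift n l (x • 1 + ħ • starSum f y) := by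
  rw [linFactor, starSum_inr_eq_shift, map_add, map_smul, map_smul, map_one]

theorem intertwiner_eq_shift (ħ : ℂ) (f : Fin m ↪ Fin l) (g : Fin (r + 1) ↪ Fin l) (u w : ℂ) :
    intertwiner n ħ f g u w = shift n l ((List.finRange (r + 1)).map fun j : Fin (r + 1) =>
      (u - (w + (j : ℕ) * ħ)) • (1 : GroupAlg (Fin l)) + ħ • starSum f (g j)).reverse.prod := by
  rw [intertwiner, map_list_prod, List.map_reverse, List.map_map]
  simp only [linFactor_inr_eq_shift, Function.comp_def]

theorem isUnit_reverse_prod {M ι : Type*} [Monoid M] (F : ι → M) (L : List ι)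
    (h : ∀ j, IsUnit (F j)) : IsUnit (L.map F).reverse.prod := by
  rw [← List.map_reverse]
  induction L.reverse with
  | nil => simp
  | cons a L ih => simpa using (h a).mul ih

/-- Two factors at neighbouring positions are exchanged by `1 + s`. -/
theorem alternating_mul_intertwiner {ħ : ℂ} {f : Fin m ↪ Fin l} {g : Fin (r + 1) ↪ Fin l}
    (hfg : ∀ i j, f i ≠ g j) (u w : ℂ) (j : Fin r) {A : GroupAlg (Fin n ⊕ Fin l)}
    (hA : A * perm (Equiv.swap (Sum.inr (g j.castSucc)) (Sum.inr (g j.succ))) = -A) :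
    A * intertwiner n ħ f g u w *
      perm (Equiv.swap (Sum.inr (g j.castSucc)) (Sum.inr (g j.succ))) =
        -(A * intertwiner n ħ f g u w) := by
  set s : GroupAlg (Fin n ⊕ Fin l) :=
    perm (Equiv.swap (Sum.inr (g j.castSucc)) (Sum.inr (g j.succ))) with hs
  set R : Fin (r + 1) → GroupAlg (Fin n ⊕ Fin l) := fun j =>
    linFactor ħ f (u - (w + (j : ℕ) * ħ)) (Sum.inr (g j)) with hR
  obtain ⟨L₁, L₂, hL⟩ : ∃ L₁ L₂, List.finRange (r + 1) = L₁ ++ j.castSucc :: j.succ :: L₂ := by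
    refine ⟨(List.finRange (r + 1)).take j, (List.finRange (r + 1)).drop (j + 2), ?_⟩
    conv_lhs => rw [← List.take_append_drop j (List.finRange (r + 1))]
    rw [List.drop_eq_getElem_cons (by simp), List.drop_eq_getElem_cons (by simp)]
    congr 2
    · simp [Fin.ext_iff]
    · congr 1
      simp [Fin.ext_iff]
  have hnd : (L₁ ++ j.castSucc :: j.succ :: L₂).Nodup := hL ▸ List.nodup_finRange _
  rw [List.nodup_append'] at hnd
  obtain ⟨-, h2, h3⟩ := hnd
  rw [List.nodup_cons, List.nodup_cons] at h2
  have hcomm : ∀ i, i ≠ j.castSucc → i ≠ j.succ → Commute s (R i) := by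
    intro i h1 h2
    refine commute_perm_linFactor (ρ := 1) (fun e => ?_) ?_ _ _
    · exact Equiv.swap_apply_of_ne_of_ne (by simpa using hfg _ _) (by simpa using hfg _ _)
    · exact Equiv.swap_apply_of_ne_of_ne (by simpa using h1) (by simpa using h2)
  have hc1 : Commute (1 + s) (L₁.map R).reverse.prod := by
    rw [← List.map_reverse]
    refine (Commute.one_left _).add_left (commute_list_map_prod fun i hi => hcomm i ?_ ?_)
    · rintro rfl; exact h3 (List.mem_reverse.mp hi) (by simp)
    · rintro rfl; exact h3 (List.mem_reverse.mp hi) (by simp)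
  have hc2 : Commute (1 + s) (L₂.map R).reverse.prod := by
    rw [← List.map_reverse]
    refine (Commute.one_left _).add_left (commute_list_map_prod fun i hi => hcomm i ?_ ?_)
    · rintro rfl; exact h2.1 (List.mem_cons_of_mem _ (List.mem_reverse.mp hi))
    · rintro rfl; exact h2.2.1 (List.mem_reverse.mp hi)
  have hne : (Sum.inr (g j.castSucc) : Fin n ⊕ Fin l) ≠ Sum.inr (g j.succ) := by
    simpa using (Fin.castSucc_lt_succ (i := j)).ne
  have hf1 : ∀ e i, (Sum.inr (f i) : Fin n ⊕ Fin l) ≠ Sum.inr (g e) := fun e i => by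
    simpa using hfg i e
  have hex : (1 + s) * (R j.castSucc * R j.succ) = R j.succ * R j.castSucc * (1 + s) := by
    refine exchange_symm ?_ ?_ ?_ ħ _ _ ?_
    · exact swap_mul_starSum (hf1 _) (hf1 _)
    · rw [hs, Equiv.swap_comm]; exact swap_mul_starSum (hf1 _) (hf1 _)
    · exact starSum_commutator (Sum.inr_injective.comp f.injective) hne (hf1 _) (hf1 _)
    · simp; ring
  have hI : intertwiner n ħ f g u w =
      (L₂.map R).reverse.prod * (R j.succ * R j.castSucc) * (L₁.map R).reverse.prod := by
    rw [intertwiner, hL]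
    simp [mul_assoc, hR]
  have hA' : A * (1 + s) = 0 := by rw [mul_add, hA, mul_one, add_neg_cancel]
  have : A * intertwiner n ħ f g u w * (1 + s) = 0 := by
    rw [hI]
    calc A * ((L₂.map R).reverse.prod * (R j.succ * R j.castSucc) * (L₁.map R).reverse.prod) *
          (1 + s)
        = A * (L₂.map R).reverse.prod * (R j.succ * R j.castSucc * (1 + s)) *
          (L₁.map R).reverse.prod := by
          simp only [mul_assoc, hc1.eq]
      _ = A * ((1 + s) * (L₂.map R).reverse.prod) * (R j.castSucc * R j.succ) *
          (L₁.map R).reverse.prod := by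
          rw [← hex, hc2.eq]; simp only [mul_assoc]
      _ = 0 := by rw [← mul_assoc A, hA']; simp
  rw [mul_add, mul_one] at this
  exact (neg_eq_of_add_eq_zero_right this).symm

theorem antisymmetrizer_mul_swap {k : ℕ} (g : Fin k ↪ Fin l) {i j : Fin k} (hij : i ≠ j) :
    tailAlg n g (antisymmetrizer k) * perm (Equiv.swap (Sum.inr (g i)) (Sum.inr (g j))) =
      -tailAlg n g (antisymmetrizer k) := by
  rw [← tailPerm_swap, ← tailAlg_perm, ← map_mul, antisymmetrizer_mul_perm,
    Equiv.Perm.sign_swap hij]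
  simp

theorem antisymmetrizer_mul_intertwiner_mul {f : Fin m ↪ Fin l} {g : Fin (r + 1) ↪ Fin l}
    (hfg : ∀ i j, f i ≠ g j) (ħ u w : ℂ) :
    tailAlg n g (antisymmetrizer (r + 1)) * intertwiner n ħ f g u w *
      tailAlg n g (antisymmetrizer (r + 1)) =
        tailAlg n g (antisymmetrizer (r + 1)) * intertwiner n ħ f g u w := by
  refine mul_map_antisymmetrizer (tailAlg n g) fun j => ?_
  rw [tailAlg_perm, tailPerm_swap]
  exact alternating_mul_intertwiner hfg u w j
    (antisymmetrizer_mul_swap g (Fin.castSucc_lt_succ (i := j)).ne)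

/-- The ordered product of the unfused factors at the symbol `a`. -/
def unfused (ħ : ℂ) (g : Fin (r + 1) ↪ Fin l) (x : ℂ) (a : Fin n) : GroupAlg (Fin n ⊕ Fin l) :=
  ((List.finRange (r + 1)).map fun j : Fin (r + 1) =>
    (x + (j : ℕ) * ħ) • (1 : GroupAlg (Fin n ⊕ Fin l)) +
    ħ • perm (Equiv.swap (Sum.inl a) (Sum.inr (g j)))).prod

theorem antisymmetrizer_mul_unfused (ħ x : ℂ) (g : Fin (r + 1) ↪ Fin l) (a : Fin n) :
    tailAlg n g (antisymmetrizer (r + 1)) * unfused ħ g x a =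
      (∏ j : Fin r, (x + (j : ℕ) * ħ)) • (linFactor ħ g (x + r * ħ) (Sum.inl a) *
        tailAlg n g (antisymmetrizer (r + 1))) := by
  rw [unfused, ← List.ofFn_eq_map, fusion _ (Sum.inl a) ħ x (fun j => Sum.inr (g j))
    (Sum.inr_injective.comp g.injective) (by simp)
    (fun i j hij => antisymmetrizer_mul_swap g hij)]
  congr 1
  exact (commute_tailAlg_linFactor_self g ħ _ a _).eq

theorem intertwiner_mul {f : Fin m ↪ Fin l} {g : Fin (r + 1) ↪ Fin l}
    (hfg : ∀ i j, f i ≠ g j) (ħ u w z : ℂ) (a : Fin n) :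
    intertwiner n ħ f g u w * (linFactor ħ f (u - z) (Sum.inl a) * unfused ħ g (w - z) a) =
      unfused ħ g (w - z) a * linFactor ħ f (u - z) (Sum.inl a) * intertwiner n ħ f g u w := by
  have hf1 : ∀ e i, (Sum.inr (f i) : Fin n ⊕ Fin l) ≠ Sum.inr (g e) := fun e i => by
    simpa using hfg i e
  have hf2 : ∀ i, (Sum.inr (f i) : Fin n ⊕ Fin l) ≠ Sum.inl a := fun i => by simp
  refine reverse_prod_exchange (List.nodup_finRange _) (fun j _ => ?_) (fun i _ j _ hij => ?_)
  · refine exchange ?_ ?_ ?_ ħ _ _ _ ?_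
    · rw [Equiv.swap_comm]; exact swap_mul_starSum (hf1 _) hf2
    · exact swap_mul_starSum hf2 (hf1 _)
    · rw [Equiv.swap_comm]
      exact starSum_commutator (Sum.inr_injective.comp f.injective) (by simp) (hf1 _) hf2
    · ring
  · refine commute_affine (commute_perm_linFactor (ρ := 1) (fun e => ?_) ?_ _ _).symm _ _
    · exact Equiv.swap_apply_of_ne_of_ne (hf2 _) (hf1 _ _)
    · exact Equiv.swap_apply_of_ne_of_ne (by simp) (by simpa using hij)

/-- The two orders of the fused factors have the same partial trace. -/
theorem partialTrace_linFactor_comm {f : Fin m ↪ Fin l} {g : Fin (r + 1) ↪ Fin l}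
    (hfg : ∀ i j, f i ≠ g j) (z : Fin n → ℂ) (p ħ u w : ℂ) (L : List (Fin n))
    (hc : ∀ a, ∏ j : Fin r, (w - z a + (j : ℕ) * ħ) ≠ 0)
    (hu : ∀ j : Fin (r + 1),
      IsUnit ((u - (w + (j : ℕ) * ħ)) • (1 : GroupAlg (Fin l)) + ħ • starSum f (g j))) :
    partialTrace n l p (tailAlg n f (antisymmetrizer m) * tailAlg n g (antisymmetrizer (r + 1)) *
        (L.map fun a => linFactor ħ f (u - z a) (Sum.inl a) *
          linFactor ħ g (w - z a + r * ħ) (Sum.inl a)).prod) =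
      partialTrace n l p (tailAlg n f (antisymmetrizer m) * tailAlg n g (antisymmetrizer (r + 1)) *
        (L.map fun a => linFactor ħ g (w - z a + r * ħ) (Sum.inl a) *
          linFactor ħ f (u - z a) (Sum.inl a)).prod) := by
  obtain ⟨R', hR'⟩ := isUnit_reverse_prod _ (List.finRange (r + 1)) hu
  have hI := intertwiner_eq_shift (n := n) ħ f g u w
  rw [← hR'] at hI
  refine trace_exchange (partialTrace n l p) (shift n l).range ?_
    (A := tailAlg n g (antisymmetrizer (r + 1))) (R := intertwiner n ħ f g u w)
    (R' := shift n l (R'⁻¹).1)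
    (W := (L.map fun a => linFactor ħ f (u - z a) (Sum.inl a) * unfused ħ g (w - z a) a).prod)
    (W' := (L.map fun a => unfused ħ g (w - z a) a * linFactor ħ f (u - z a) (Sum.inl a)).prod)
    (c := (L.map fun a => ∏ j : Fin r, (w - z a + (j : ℕ) * ħ)).prod)
    ?_ (tailAlg_mem_range _ _) (tailAlg_mem_range _ _) (hI ▸ ⟨_, rfl⟩) ?_ ?_ ?_ ?_ ?_ ?_ ?_ ?_ ?_ ?_
    ?_
  · rintro _ ⟨y, rfl⟩ x
    exact partialTrace_mul_shift p x y
  · refine List.prod_ne_zero fun h0 => ?_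
    obtain ⟨a, -, ha⟩ := List.mem_map.mp h0
    exact hc a ha
  · rw [← map_mul, antisymmetrizer_mul_self]
  · exact antisymmetrizer_mul_intertwiner_mul hfg ħ u w
  · rw [hI, ← map_mul, Units.mul_inv, map_one]
  · rw [hI, ← map_mul, Units.inv_mul, map_one]
  · exact commute_tailAlg_tailAlg hfg _ _
  · rw [intertwiner, ← List.map_reverse]
    exact commute_list_map_prod fun j _ => commute_tailAlg_linFactor_inr hfg _ _ _ _
  · refine mul_list_prod_smul L fun a _ => ?_
    rw [← mul_assoc, (commute_tailAlg_linFactor hfg ħ _ a _).eq, mul_assoc,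
      antisymmetrizer_mul_unfused, mul_smul_comm, mul_assoc]
  · refine mul_list_prod_smul L fun a _ => ?_
    rw [← mul_assoc, antisymmetrizer_mul_unfused, smul_mul_assoc, mul_assoc,
      (commute_tailAlg_linFactor hfg ħ _ a _).eq, mul_assoc]
  · exact commute_list_map_prod fun a _ =>
      (commute_tailAlg_linFactor hfg ħ _ a _).mul_right (commute_tailAlg_linFactor_self g ħ _ a _)
  · exact commute_list_map_prod fun a _ =>
      (commute_tailAlg_linFactor_self g ħ _ a _).mul_right (commute_tailAlg_linFactor hfg ħ _ a _)
  · exact mul_list_prod_semiconj L fun a _ => intertwiner_mul hfg ħ u w (z a) a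

end intertwiner

/-! ### Evaluation of polynomials at central elements -/

section eval

variable {𝒜 : Type*} [Ring 𝒜] [Algebra ℂ 𝒜]

/-- Evaluation of a polynomial over a complex algebra at a complex number. -/
def evalAt (u : ℂ) : 𝒜[X] →+* 𝒜 :=
  eval₂RingHom' (RingHom.id 𝒜) (algebraMap ℂ 𝒜 u) fun a => (Algebra.commutes u a).symm

theorem evalAt_C (u : ℂ) (a : 𝒜) : evalAt u (C a) = a := eval₂_C _ _

theorem evalAt_X (u : ℂ) : evalAt u (X : 𝒜[X]) = u • 1 := by
  rw [← Algebra.algebraMap_eq_smul_one]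
  exact eval₂_X _ _

theorem evalAt_monomial (u : ℂ) (k : ℕ) (a : 𝒜) : evalAt u (monomial k a) = u ^ k • a := by
  rw [← C_mul_X_pow_eq_monomial, map_mul, map_pow, evalAt_C, evalAt_X, _root_.smul_pow, one_pow,
    mul_smul_comm, mul_one]

theorem evalAt_eq_sum (u : ℂ) (P : 𝒜[X]) : evalAt u P = P.sum fun k a => u ^ k • a := by
  conv_lhs => rw [← sum_monomial_eq P]
  rw [Polynomial.sum, map_sum, Polynomial.sum]
  simp only [evalAt_monomial]

/-- A polynomial that vanishes at infinitely many complex numbers is zero. -/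
theorem eq_zero_of_evalAt_eq_zero {P : 𝒜[X]} {s : Set ℂ} (hs : s.Infinite)
    (h : ∀ u ∈ s, evalAt u P = 0) : P = 0 := by
  ext i
  rw [coeff_zero, ← Module.forall_dual_apply_eq_zero_iff ℂ]
  intro φ
  let Q : ℂ[X] := ∑ k ∈ P.support, monomial k (φ (P.coeff k))
  have hQ : Q = 0 := by
    refine Polynomial.eq_zero_of_infinite_isRoot Q (hs.mono fun u hu => ?_)
    have := congrArg φ (h u hu)
    rw [evalAt_eq_sum, Polynomial.sum, map_sum, map_zero] at this
    change Q.eval u = 0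
    rw [← this, eval_finsetSum]
    simp only [eval_monomial, map_smul, smul_eq_mul, mul_comm]
  have hi : Q.coeff i = φ (P.coeff i) := by
    simp only [Q, finsetSum_coeff, coeff_monomial]
    rw [Finset.sum_ite_eq']
    split_ifs with hi
    · rfl
    · rw [notMem_support_iff.mp hi, map_zero]
  rw [← hi, hQ, coeff_zero]

theorem commute_coeff_of_commute_evalAt {P : 𝒜[X]} {y : 𝒜} {s : Set ℂ} (hs : s.Infinite)
    (h : ∀ u ∈ s, Commute (evalAt u P) y) (i : ℕ) : Commute (P.coeff i) y := by
  have h0 : P * C y - C y * P = 0 := eq_zero_of_evalAt_eq_zero hs fun u hu => by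
    rw [map_sub, map_mul, map_mul, evalAt_C, (h u hu).eq, sub_self]
  have := congrArg (fun Q => Q.coeff i) h0
  rw [coeff_sub, coeff_mul_C, coeff_C_mul, coeff_zero] at this
  exact sub_eq_zero.mp this

theorem finite_not_isUnit_affine [FiniteDimensional ℂ 𝒜] (a : 𝒜) (c ħ : ℂ) :
    {u : ℂ | ¬IsUnit ((u - c) • (1 : 𝒜) + ħ • a)}.Finite := by
  refine ((finite_spectrum_of_finiteDimensional (-(ħ • a))).image (· + c)).subset fun u hu => ?_
  refine ⟨u - c, fun h => hu ?_, sub_add_cancel u c⟩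
  change IsUnit _ at h
  rwa [sub_neg_eq_add, Algebra.algebraMap_eq_smul_one] at h

end eval

/-! ### The transfer matrices -/

section transfer

variable {n m k l : ℕ}

theorem evalAt_partialTracePoly (p u : ℂ) (P : (GroupAlg (Fin n ⊕ Fin m))[X]) :
    evalAt u (partialTracePoly n m p P) = partialTrace n m p (evalAt u P) := by
  rw [partialTracePoly, evalAt_eq_sum u P, Polynomial.sum, Polynomial.sum, map_sum, map_sum]
  simp only [evalAt_monomial, map_smul]

theorem evalAt_factor (z : Fin n → ℂ) (ħ u : ℂ) (a : Fin n) :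
    evalAt u (factor m z ħ a) = (u - z a) • 1 + ħ • starSum Sum.inr (Sum.inl a) := by
  rw [factor, map_add, map_sub, evalAt_C, evalAt_C, evalAt_X, Algebra.algebraMap_eq_smul_one,
    sub_smul, starSum]

theorem evalAt_T (z : Fin n → ℂ) (p ħ u : ℂ) :
    evalAt u (T m z p ħ) = partialTrace n m p (shift n m (antisymmetrizer m) *
      ((List.finRange n).reverse.map fun a =>
        (u - z a) • (1 : GroupAlg (Fin n ⊕ Fin m)) +
          ħ • starSum Sum.inr (Sum.inl a)).prod) := by
  rw [T, evalAt_partialTracePoly, map_mul, evalAt_C, map_list_prod, List.ofFn_eq_map,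
    ← List.map_reverse, List.map_map]
  simp only [Function.comp_def, evalAt_factor]

theorem relabelPerm_swap (f : Fin m ↪ Fin l) (a : Fin n) (i : Fin m) :
    relabelPerm n f (Equiv.swap (Sum.inl a) (Sum.inr i)) =
      Equiv.swap (Sum.inl a) (Sum.inr (f i)) := by
  ext1 x
  have h : ∀ y, relabelPerm n f (Equiv.swap (Sum.inl a) (Sum.inr i)) (relabel n f y) =
      Equiv.swap (Sum.inl a) (Sum.inr (f i)) (relabel n f y) := fun y =>
    (Equiv.Perm.viaEmbedding_apply _ (relabel n f) y).trans
      ((relabel n f).injective.map_swap (Sum.inl a) (Sum.inr i) y)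
  rcases x with b | x
  · exact h (Sum.inl b)
  · by_cases hx : x ∈ Set.range f
    · obtain ⟨j, rfl⟩ := hx
      exact h (Sum.inr j)
    · rw [relabelPerm_of_notMem f _ hx, Equiv.swap_apply_of_ne_of_ne (by simp)]
      intro h
      exact hx ⟨i, (Sum.inr.inj h).symm⟩

theorem relabelAlg_linear (f : Fin m ↪ Fin l) (ħ x : ℂ) (a : Fin n) :
    relabelAlg n f (x • 1 + ħ • starSum Sum.inr (Sum.inl a)) = linFactor ħ f x (Sum.inl a) := by
  rw [map_add, map_smul, map_smul, map_one, linFactor, starSum, starSum, map_sum]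
  simp only [relabelAlg_perm, relabelPerm_swap]

/-- A product of two transfer matrices as a single partial trace. -/
theorem evalAt_T_mul_evalAt_T {f : Fin m ↪ Fin l} {g : Fin k ↪ Fin l}
    (hfg : ∀ i j, f i ≠ g j) (hcov : ∀ x, x ∈ Set.range f ∨ x ∈ Set.range g)
    (z : Fin n → ℂ) (p ħ u v : ℂ) :
    evalAt u (T m z p ħ) * evalAt v (T k z p ħ) = partialTrace n l p
      (tailAlg n f (antisymmetrizer m) * tailAlg n g (antisymmetrizer k) *
        ((List.finRange n).reverse.map fun a => linFactor ħ f (u - z a) (Sum.inl a) *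
          linFactor ħ g (v - z a) (Sum.inl a)).prod) := by
  have hx : ∀ (e : ℕ) (f : Fin e ↪ Fin l) (u : ℂ), relabelAlg n f
      (shift n e (antisymmetrizer e) * ((List.finRange n).reverse.map fun a =>
        (u - z a) • (1 : GroupAlg (Fin n ⊕ Fin e)) +
          ħ • starSum Sum.inr (Sum.inl a)).prod) = tailAlg n f (antisymmetrizer e) *
      ((List.finRange n).reverse.map fun a => linFactor ħ f (u - z a) (Sum.inl a)).prod := by
    intro e f u
    rw [map_mul, relabelAlg_shift, map_list_prod, List.map_map]
    simp only [Function.comp_def, relabelAlg_linear]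
  have hnd : (List.finRange n).reverse.Nodup := List.nodup_reverse.mpr (List.nodup_finRange n)
  have hc : Commute (tailAlg n g (antisymmetrizer k))
      ((List.finRange n).reverse.map fun a => linFactor ħ f (u - z a) (Sum.inl a)).prod :=
    commute_list_map_prod fun a _ => commute_tailAlg_linFactor hfg _ _ _ _
  have hp := list_prod_mul_list_prod
    (x := fun a : Fin n => linFactor ħ f (u - z a) (Sum.inl a))
    (y := fun a : Fin n => linFactor ħ g (v - z a) (Sum.inl a)) hnd
    fun a _ b _ hab => commute_linFactor_linFactor hfg ħ (u - z a) (v - z b) hab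
  rw [evalAt_T, evalAt_T, ← partialTrace_relabel_mul hfg hcov, hx, hx, ← hp]
  exact congrArg _ (hc.symm.mul_mul_mul_comm _ _)

theorem commute_evalAt_T {r : ℕ} (z : Fin n → ℂ) (p ħ u w : ℂ)
    (hc : ∀ a, ∏ j : Fin r, (w - z a + (j : ℕ) * ħ) ≠ 0)
    (hu : ∀ j : Fin (r + 1), IsUnit ((u - (w + (j : ℕ) * ħ)) •
      (1 : GroupAlg (Fin (m + (r + 1)))) +
        ħ • starSum (Fin.castAddEmb (r + 1)) (Fin.natAdd m j))) :
    Commute (evalAt u (T m z p ħ)) (evalAt (w + r * ħ) (T (r + 1) z p ħ)) := by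
  have hfg : ∀ i j, Fin.castAddEmb (r + 1) i ≠ Fin.natAddEmb m j := fun i j h => by
    have := congrArg Fin.val h
    simp at this
    omega
  have hcov : ∀ x : Fin (m + (r + 1)), x ∈ Set.range (Fin.castAddEmb (r + 1)) ∨
      x ∈ Set.range (Fin.natAddEmb m) := fun x => by
    induction x using Fin.addCases with
    | left i => exact Or.inl ⟨i, rfl⟩
    | right j => exact Or.inr ⟨j, rfl⟩
  have h := partialTrace_linFactor_comm hfg z p ħ u w (List.finRange n).reverse hc hu
  have e : ∀ a, w - z a + r * ħ = w + r * ħ - z a := fun a => by ring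
  simp only [e] at h
  rw [Commute, SemiconjBy, evalAt_T_mul_evalAt_T hfg hcov, h,
    evalAt_T_mul_evalAt_T (fun i j => (hfg j i).symm) (fun x => (hcov x).symm),
    (commute_tailAlg_tailAlg hfg _ _).eq]

theorem commute_coeff_T (z : Fin n → ℂ) (p ħ : ℂ) (hk : 1 ≤ k) (i j : ℕ) :
    Commute ((T m z p ħ).coeff i) ((T k z p ħ).coeff j) := by
  obtain ⟨r, rfl⟩ := Nat.exists_eq_add_of_le' hk
  let s : Set ℂ := {w | ∀ a, ∏ j : Fin r, (w - z a + (j : ℕ) * ħ) ≠ 0}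
  have hs : sᶜ.Finite := by
    have : sᶜ ⊆ ⋃ a : Fin n, ⋃ j : Fin r, {z a - (j : ℕ) * ħ} := by
      intro w hw
      simp only [s, Set.mem_compl_iff, Set.mem_ofPred_eq, not_forall, not_not,
        Finset.prod_eq_zero_iff] at hw
      obtain ⟨a, j, -, h⟩ := hw
      simp only [Set.mem_iUnion, Set.mem_singleton_iff]
      exact ⟨a, j, by linear_combination h⟩
    exact (Set.finite_iUnion fun a => Set.finite_iUnion fun j => Set.finite_singleton _).subset this
  have hsi : s.Infinite := fun h => Set.infinite_univ (Set.union_compl_self s ▸ h.union hs)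
  have key : ∀ w ∈ s, Commute ((T m z p ħ).coeff i) (evalAt (w + r * ħ) (T (r + 1) z p ħ)) := by
    intro w hw
    let t : Set ℂ := {u | ∀ j : Fin (r + 1), IsUnit ((u - (w + (j : ℕ) * ħ)) •
      (1 : GroupAlg (Fin (m + (r + 1)))) +
        ħ • starSum (Fin.castAddEmb (r + 1)) (Fin.natAdd m j))}
    have ht : tᶜ.Finite := by
      refine (Set.finite_iUnion fun j : Fin (r + 1) => finite_not_isUnit_affine
        (starSum (Fin.castAddEmb (r + 1)) (Fin.natAdd m j)) (w + (j : ℕ) * ħ) ħ).subset ?_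
      intro u hu
      simp only [t, Set.mem_compl_iff, Set.mem_ofPred_eq, not_forall] at hu
      exact Set.mem_iUnion.mpr hu
    have hti : t.Infinite := fun h => Set.infinite_univ (Set.union_compl_self t ▸ h.union ht)
    exact commute_coeff_of_commute_evalAt hti (fun u hu => commute_evalAt_T z p ħ u w hw hu) i
  refine (commute_coeff_of_commute_evalAt (s := (· + (r : ℂ) * ħ) '' s)
    (hsi.image (add_left_injective _).injOn) ?_ j).symm
  rintro _ ⟨w, hw, rfl⟩
  exact (key w hw).symm

end transfer

end BetheXXX

end

theorem theorem5p12 (n : ℕ) (z : Fin n → ℂ) (p ħ : ℂ) :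
    ∀ x ∈ BetheXXX.betheSubalgebra z p ħ, ∀ y ∈ BetheXXX.betheSubalgebra z p ħ,
      x * y = y * x := by
  intro x hx y hy
  refine Algebra.commute_of_mem_adjoin_of_forall_mem_commute hy fun b hb => ?_
  refine (Algebra.commute_of_mem_adjoin_of_forall_mem_commute hx fun a ha => ?_).symm
  obtain ⟨m, i, -, -, -, -, rfl⟩ := ha
  obtain ⟨k, j, hk, -, -, -, rfl⟩ := hb
  exact (BetheXXX.commute_coeff_T z p ħ hk _ _).symm
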